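/- Let $V$ be a complex vector space with basis $x_1,\dots,x_N$ and let $R(x_i\otimes x_j)=R_{ij}^{kl}\,x_k\otimes x_l$ be an involutive symmetry on $V\otimes V$, i.e. $R^2=I$ and $R_{12}R_{23}R_{12}=R_{23}R_{12}R_{23}$ on $V^{\otimes 3}$ (the lower indices of a matrix number its rows, the upper ones its columns; $R_{k\,k+1}$ is $R$ acting in the factors $k,k+1$ of a tensor power of $V$). Assume that $R$ is even: for some $m\ge 2$ the homogeneous component $\Lambda_R^{(m)}(V)$ of the algebra $\Lambda_R(V)=T(V)/\langle \mathrm{Im}(I+R)\rangle$ is one-dimensional and $\Lambda_R^{(k)}(V)=0$ for all $k>m$. Let $A^{(1)}=I$, $A^{(k)}=\frac1k A^{(k-1)}\bigl(I-(k-1)R_{k-1\,k}\bigr)A^{(k-1)}$ be the $R$-skew-symmetrizers. Let $\mathcal L(R,R)$ be the unital associative $\mathbb C$-algebra generated by the entries of the $N\times N$ matrix $L=\|l_i^j\|$ subject to $R_{12}L_{\overline 1}L_{\overline 2}=L_{\overline 1}L_{\overline 2}R_{12}$, where for an $N\times N$ matrix $X$ we put $X_{\overline 1}=X\otimes I\otimes\cdots\otimes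 I$ and $X_{\overline{k+1}}=R_{k\,k+1}X_{\overline k}R_{k\,k+1}^{-1}$. Then there are tensors $u=\|u_{i_1\dots i_m}\|$ and $v=\|v^{j_1\dots j_m}\|$ with $$A^{(m)}(x_{i_1}\otimes\cdots\otimes x_{i_m})=u_{i_1\dots i_m}v^{j_1\dots j_m}x_{j_1}\otimes\cdots\otimes x_{j_m},\qquad v^{i_1\dots i_m}u_{i_1\dots i_m}=1,$$ and for every such pair the polynomial in the central variable $t$ $$D(t)={\det}_{\mathcal L(R,R)}(L-tI)=v^{i_1\dots i_m}\bigl((L-tI)_{\overline 1}\cdots(L-tI)_{\overline m}\bigr)_{i_1\dots i_m}^{j_1\dots j_m}u_{j_1\dots j_m}\in\mathcal L(R,R)[t]$$ is, up to the sign $(-1)^m$, characteristic for $L$: the polynomial $(-1)^mD(t)=\sum_{k=0}^m c_k t^k$ is monic of degree $m$, and it vanishes when $L$ is substituted for $t$, i.e. $\sum_{k=0}^m c_k L^k=0$ in the algebra of $N\times N$ matrices over $\mathcal L(R,R)$. -/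

import Mathlib

noncomputable section

namespace RE

open Polynomial

/-- `R (i, j) (k, l)` is the coefficient `R_{ij}^{kl}` of the operator
`R (x_i ⊗ x_j) = ∑ R_{ij}^{kl} x_k ⊗ x_l` on `V ⊗ V`, `V = ℂ^N` with basis `x_i`:
the row index of a matrix is the lower index, the column index the upper one. -/
abbrev Op2 (N : ℕ) := Matrix (Fin N × Fin N) (Fin N × Fin N) ℂ

/-- Square matrices with entries in `A` of the size of `V^{⊗ p}`. -/
abbrev MatT (N p : ℕ) (A : Type*) := Matrix (Fin p → Fin N) (Fin p → Fin N) A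

/-- `R` acting in the tensor factors number `k` and `k + 1` of `V^{⊗ p}`; factors are numbered
from `0`. (Used only for `k + 1 < p`; the value is `1` otherwise.) -/
def site2 {N : ℕ} (R : Op2 N) (p k : ℕ) : MatT N p ℂ := fun i j =>
  if h : k + 1 < p then
    if ∀ l : Fin p, l.val ≠ k → l.val ≠ k + 1 → i l = j l then
      R (i ⟨k, by omega⟩, i ⟨k + 1, h⟩) (j ⟨k, by omega⟩, j ⟨k + 1, h⟩)
    else 0
  else (1 : MatT N p ℂ) i j

/-- `X ⊗ I ⊗ ⋯ ⊗ I` on `V^{⊗ p}`, for an `N × N` matrix `X` with entries in an algebra.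
(Used only for `0 < p`; the value is `1` otherwise.) -/
def site1 {N : ℕ} {A : Type*} [Ring A] (X : Matrix (Fin N) (Fin N) A) (p : ℕ) : MatT N p A :=
  fun i j =>
    if h : 0 < p then
      if ∀ l : Fin p, l.val ≠ 0 → i l = j l then X (i ⟨0, h⟩) (j ⟨0, h⟩) else 0
    else (1 : MatT N p A) i j

/-- Braid relation `(R ⊗ I)(I ⊗ R)(R ⊗ I) = (I ⊗ R)(R ⊗ I)(I ⊗ R)` on `V^{⊗ 3}`. -/
def IsBraiding {N : ℕ} (R : Op2 N) : Prop :=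
  site2 R 3 0 * site2 R 3 1 * site2 R 3 0 = site2 R 3 1 * site2 R 3 0 * site2 R 3 1

/-- Involutive symmetry: a braiding with `R² = I`. -/
structure IsInvolutiveSymmetry {N : ℕ} (R : Op2 N) : Prop where
  braid : IsBraiding R
  sq_eq_one : R * R = 1

/-! ### The `R`-skew-symmetric algebra and even symmetries -/

/-- The generators `x_i x_j + ∑ R_{ij}^{kl} x_k x_l` of the ideal `⟨Im (I + R)⟩` of
`T(V) = ℂ⟨x_1, …, x_N⟩` are set to zero. -/
def skewRel {N : ℕ} (R : Op2 N) (a b : FreeAlgebra ℂ (Fin N)) : Prop :=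
  ∃ i j : Fin N,
    a = FreeAlgebra.ι ℂ i * FreeAlgebra.ι ℂ j
        + ∑ k, ∑ l, R (i, j) (k, l) • (FreeAlgebra.ι ℂ k * FreeAlgebra.ι ℂ l) ∧
    b = 0

/-- The `R`-skew-symmetric algebra `Λ_R(V) = T(V) / ⟨Im (I + R)⟩`. -/
abbrev SkewAlg {N : ℕ} (R : Op2 N) : Type := RingQuot (skewRel R)

/-- The image of `x_i` in `Λ_R(V)`. -/
def SkewAlg.gen {N : ℕ} (R : Op2 N) (i : Fin N) : SkewAlg R :=
  RingQuot.mkAlgHom ℂ (skewRel R) (FreeAlgebra.ι ℂ i)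

/-- The homogeneous component `Λ_R^{(k)}(V)`, spanned by the words of length `k`. -/
def SkewAlg.component {N : ℕ} (R : Op2 N) (k : ℕ) : Submodule ℂ (SkewAlg R) :=
  Submodule.span ℂ
    (Set.range fun w : Fin k → Fin N => (List.ofFn fun a => SkewAlg.gen R (w a)).prod)

/-- `R` is even, and `Λ_R^{(m)}(V)` is the highest non-zero homogeneous component of `Λ_R(V)`:
it is one-dimensional and all higher ones vanish. -/
structure IsEven {N : ℕ} (R : Op2 N) (m : ℕ) : Prop where
  top : Module.finrank ℂ (SkewAlg.component R m) = 1
  above : ∀ k, m < k → SkewAlg.component R k = ⊥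

/-! ### Skew-symmetrizers and the tensors `u`, `v` -/

/-- The skew-symmetrizer `A^{(k)}` of an involutive symmetry, acting in the first `k` factors of
`V^{⊗ p}`: `A^{(1)} = I`,
`A^{(k)} = (1/k) A^{(k-1)} (I - (k-1) R_{k-1,k}) A^{(k-1)}`. -/
def skewSymm {N : ℕ} (R : Op2 N) (p : ℕ) : ℕ → MatT N p ℂ
  | 0 => 1
  | 1 => 1
  | k + 2 => ((k + 2 : ℂ)⁻¹) •
      (skewSymm R p (k + 1) * (1 - ((k + 1 : ℂ)) • site2 R p k) * skewSymm R p (k + 1))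

/-- Tensors `u = ‖u_{i_1…i_m}‖`, `v = ‖v^{j_1…j_m}‖` with
`A^{(m)} (x_{i_1} ⊗ ⋯ ⊗ x_{i_m}) = u_{i_1…i_m} ∑ v^{j_1…j_m} x_{j_1} ⊗ ⋯ ⊗ x_{j_m}`
and `⟨v, u⟩ = 1`. -/
structure IsTensorPair {N : ℕ} (R : Op2 N) (m : ℕ) (u v : (Fin m → Fin N) → ℂ) : Prop where
  skew_eq : ∀ i j, skewSymm R m m i j = u i * v j
  pairing : ∑ i, v i * u i = 1

/-! ### Quantum matrix algebras and quantum determinants -/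

/-- A complex matrix regarded as a matrix over the complex algebra `A`. -/
def scal {N p : ℕ} (A : Type*) [Ring A] [Algebra ℂ A] (M : MatT N p ℂ) : MatT N p A :=
  M.map (algebraMap ℂ A)

/-- The copies `X_{\bar 1} = X ⊗ I ⊗ ⋯ ⊗ I`, `X_{\overline{k+1}} = F_{k,k+1} X_{\bar k} F_{k,k+1}⁻¹`
of an `N × N` matrix `X` on `V^{⊗ p}`, numbered from `0`. -/
def copy {N : ℕ} {A : Type*} [Ring A] [Algebra ℂ A] (F : Op2 N)
    (X : Matrix (Fin N) (Fin N) A) (p : ℕ) : ℕ → MatT N p A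
  | 0 => site1 X p
  | k + 1 => scal A (site2 F p k) * copy F X p k * scal A (site2 F⁻¹ p k)

/-- The free algebra on the symbols `l_i^j`. -/
abbrev FreeMat (N : ℕ) : Type := FreeAlgebra ℂ (Fin N × Fin N)

/-- The matrix of the free generators `l_i^j`. -/
def freeGen (N : ℕ) : Matrix (Fin N) (Fin N) (FreeMat N) := fun i j => FreeAlgebra.ι ℂ (i, j)

/-- The entries of the matrix relation
`R_{12} L_{\bar 1} L_{\bar 2} = L_{\bar 1} L_{\bar 2} R_{12}` on `V^{⊗ 2}`. -/
def qmaRel {N : ℕ} (R F : Op2 N) (a b : FreeMat N) : Prop :=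
  ∃ i j : Fin 2 → Fin N,
    a = (scal (FreeMat N) (site2 R 2 0) * copy F (freeGen N) 2 0 * copy F (freeGen N) 2 1) i j ∧
    b = (copy F (freeGen N) 2 0 * copy F (freeGen N) 2 1 * scal (FreeMat N) (site2 R 2 0)) i j

/-- The quantum matrix algebra `𝓛(R, F)`; for `F = R` it is the reflection equation algebra. -/
abbrev QMA {N : ℕ} (R F : Op2 N) : Type := RingQuot (qmaRel R F)

/-- The generating matrix `L = ‖l_i^j‖` of `𝓛(R, F)`. -/
def genMat {N : ℕ} (R F : Op2 N) : Matrix (Fin N) (Fin N) (QMA R F) := fun i j =>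
  RingQuot.mkAlgHom ℂ (qmaRel R F) (freeGen N i j)

/-- `⟨v | X_{\bar 1} ⋯ X_{\bar m} | u⟩ = ∑ v^{i_1…i_m} (X_{\bar 1} ⋯ X_{\bar m})_{i_1…i_m}^{j_1…j_m}
u_{j_1…j_m}` for a matrix `X` with entries in any complex algebra. -/
def qdet {N m : ℕ} {A : Type*} [Ring A] [Algebra ℂ A] (F : Op2 N) (u v : (Fin m → Fin N) → ℂ)
    (X : Matrix (Fin N) (Fin N) A) : A :=
  ∑ i, ∑ j, (v i * u j) • ((List.range m).map (copy F X m)).prod i j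

/-- `det_{𝓛(R,R)} (L - t I)`, a polynomial in the central variable `t` over `𝓛(R, R)`. -/
def charDet {N m : ℕ} (R : Op2 N) (u v : (Fin m → Fin N) → ℂ) : (QMA R R)[X] :=
  qdet R u v ((genMat R R).map C - Matrix.scalar (Fin N) X)

/-- A polynomial `ch = ∑ c_k t^k` over an algebra `A` is characteristic of degree `m` for a matrix
`M` over `A`, if it is monic of degree `m` and `ch(M) = ∑ c_k M^k` vanishes. -/
structure IsCharacteristic {N : ℕ} {A : Type*} [Ring A] (m : ℕ) (ch : A[X])
    (M : Matrix (Fin N) (Fin N) A) : Prop where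
  monic : ch.Monic
  natDegree_eq : ch.natDegree = m
  eval_eq_zero : ch.eval₂ (Matrix.scalar (Fin N)) M = 0

end RE

end

noncomputable section

namespace RE

open Polynomial

/-! ### Antisymmetrizers of an involutive braid system -/

/-! The proof is a Cayley–Hamilton argument with a left adjugate. Because `Λ^(m)` is a line, `A^(m)`
is an idempotent of rank one: each of its columns is a linear functional on `Λ_R(V)` evaluated at
the words of length `m`, and these words are all multiples of one vector (`exists_isTensorPair`).

Let `Y` satisfy the reflection equation; `L - t` does, since `t` is central. Then every `R_{k,k+1}`
commutes with the product `M` of the `m` copies of `Y` (`commute_copyProd`), and hence so does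
`A^(m)`. The last copy is a conjugate of `Y ⊗ I ⊗ ⋯ ⊗ I` by a product of the `R_{k,k+1}`. Each of
these acts on `A^(m)` by `-1`, so `A^(m) W (Y ⊗ I ⊗ ⋯ ⊗ I) = ± M A^(m)` for some `W`. Contracting
with `v` gives a row of the form `E Y = ± v D`, where `D` is the quantum determinant.

To pass from `v D` to the scalar matrix `D`, the tensor `v` must be inverted in its first index.
This uses `Λ^(m+1) = 0`: then `A^(m+1) = 0`, which forces `m² A A' A = A` for the skew-symmetrizers
on the first and the last `m` of `m + 1` factors (`skewSymm_temperleyLieb`). Read in rank one terms,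
this says that certain contractions of `u` and `v` are inverse matrices (`exists_rightInverse`).

The result is `B (L - t) = D(t) I` (`exists_adjugate`). Comparing powers of `t` gives a telescoping
sum, so `D(L) = 0` (`eval₂_scalar_eq_zero`); the leading coefficient is `(-1)^m ⟨v, u⟩`
(`qdet_top`). -/

/-- Elements `r 0, …, r (p - 2)` of a ring satisfying the Coxeter relations of the symmetric
group on `p` letters. -/
structure IsCoxeterFamily {E : Type*} [Ring E] (r : ℕ → E) (p : ℕ) : Prop where
  sq : ∀ i, r i * r i = 1
  braid : ∀ i, i + 2 < p → r i * r (i + 1) * r i = r (i + 1) * r i * r (i + 1)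
  comm : ∀ i j, i + 2 ≤ j → Commute (r i) (r j)

/-- The antisymmetrizers built from a sequence of generators. -/
def antisymm {E : Type*} [Ring E] [Algebra ℂ E] (r : ℕ → E) : ℕ → E
  | 0 => 1
  | 1 => 1
  | k + 2 => ((k + 2 : ℂ)⁻¹) •
      (antisymm r (k + 1) * (1 - ((k + 1 : ℂ)) • r k) * antisymm r (k + 1))

section Antisymm

variable {E : Type*} [Ring E] [Algebra ℂ E]

lemma skewSymm_eq_antisymm {N : ℕ} (R : Op2 N) (p k : ℕ) :
    skewSymm R p k = antisymm (site2 R p) k := by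
  induction k using skewSymm.induct with
  | case1 => rfl
  | case2 => rfl
  | case3 k ih => rw [skewSymm, antisymm, ih]

lemma antisymm_congr {r s : ℕ → E} (k : ℕ) (h : ∀ i, i + 1 < k → r i = s i) :
    antisymm r k = antisymm s k := by
  induction k using skewSymm.induct with
  | case1 => rfl
  | case2 => rfl
  | case3 k ih => rw [antisymm, antisymm, ih fun i hi => h i (by omega), h k (by omega)]

lemma map_antisymm {E' : Type*} [Ring E'] [Algebra ℂ E'] (f : E →ₐ[ℂ] E') (r : ℕ → E) (k : ℕ) :
    f (antisymm r k) = antisymm (fun i => f (r i)) k := by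
  induction k using skewSymm.induct with
  | case1 => simp [antisymm]
  | case2 => simp [antisymm]
  | case3 k ih => simp [antisymm, ih]

/-- An element intertwining two sequences intertwines their antisymmetrizers. -/
lemma antisymm_intertwine {r s : ℕ → E} {T : E} (k : ℕ)
    (h : ∀ i, i + 1 < k → T * r i = s i * T) :
    T * antisymm r k = antisymm s k * T := by
  induction k using skewSymm.induct with
  | case1 => simp [antisymm]
  | case2 => simp [antisymm]
  | case3 k ih =>
    have ih' := ih fun i hi => h i (by omega)
    have hk := h k (by omega)
    have h1 : T * (1 - ((k + 1 : ℂ)) • r k) = (1 - ((k + 1 : ℂ)) • s k) * T := by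
      rw [mul_sub, sub_mul, mul_one, one_mul, mul_smul_comm, smul_mul_assoc, hk]
    rw [antisymm, antisymm, mul_smul_comm, smul_mul_assoc]
    congr 1
    calc _ = T * antisymm r (k + 1) * (1 - ((k + 1 : ℂ)) • r k) * antisymm r (k + 1) := by
          simp only [mul_assoc]
      _ = antisymm s (k + 1) * (T * (1 - ((k + 1 : ℂ)) • r k)) * antisymm r (k + 1) := by
          rw [ih']; simp only [mul_assoc]
      _ = antisymm s (k + 1) * (1 - ((k + 1 : ℂ)) • s k) * (T * antisymm r (k + 1)) := by
          rw [h1]; simp only [mul_assoc]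
      _ = _ := by rw [ih']; simp only [mul_assoc]

lemma antisymm_commute {r : ℕ → E} {T : E} (k : ℕ) (h : ∀ i, i + 1 < k → Commute T (r i)) :
    Commute T (antisymm r k) :=
  antisymm_intertwine k h

/-- Here `a`, `b` play two consecutive antisymmetrizers and `s`, `t` two adjacent generators.
Expanding the last `b` of `b t b` by its recursion, and absorbing into `b` each `a` that meets it,
leaves `b - b t + n b t s a`. Right multiplication by `t` negates `b - b t` because `t² = 1`, and
negates `b t s a` by the braid relation and `b s = -b`. -/
lemma antisymm_step_right {a b s t : E} {n : ℂ} (hba : b * a = b) (hta : Commute t a)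
    (hbs : b * s = -b) (hb : (n + 1) • b = a - n • (a * s * a)) (ht : t * t = 1)
    (hst : s * t * s = t * s * t) (hbb : b * b = b) :
    b * (1 - (n + 1) • t) * b * t = -(b * (1 - (n + 1) • t) * b) := by
  have key : b * (1 - (n + 1) • t) * b = b - b * t + n • (b * t * s * a) := by
    have h1 : b * ((n + 1) • t) * b = b * t - n • (b * t * s * a) := by
      have e1 : b * t * a = b * t := by rw [mul_assoc, hta.eq, ← mul_assoc, hba]
      have e2 : b * t * (a * s * a) = b * t * s * a := by
        calc _ = b * t * a * s * a := by simp only [mul_assoc]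
          _ = _ := by rw [e1]
      rw [mul_smul_comm, smul_mul_assoc, ← mul_smul_comm, hb, mul_sub, mul_smul_comm, e1, e2]
    rw [mul_sub, sub_mul, h1, mul_one, hbb]
    abel
  have h2 : b * t * s * a * t = -(b * t * s * a) := by
    calc b * t * s * a * t = b * t * s * (t * a) := by rw [hta.eq]; simp only [mul_assoc]
      _ = b * (t * s * t) * a := by simp only [mul_assoc]
      _ = b * s * t * s * a := by rw [← hst]; simp only [mul_assoc]
      _ = _ := by rw [hbs]; simp only [neg_mul]
  rw [key, add_mul, sub_mul, smul_mul_assoc, h2, mul_assoc b t t, ht, mul_one, smul_neg]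
  abel

/-- Mirror image of `antisymm_step_right`, with normal form `b - t b + n a s t b`. -/
lemma antisymm_step_left {a b s t : E} {n : ℂ} (hab : a * b = b) (hta : Commute t a)
    (hsb : s * b = -b) (hb : (n + 1) • b = a - n • (a * s * a)) (ht : t * t = 1)
    (hst : s * t * s = t * s * t) (hbb : b * b = b) :
    t * (b * (1 - (n + 1) • t) * b) = -(b * (1 - (n + 1) • t) * b) := by
  have key : b * (1 - (n + 1) • t) * b = b - t * b + n • (a * s * t * b) := by
    have h1 : b * ((n + 1) • t) * b = t * b - n • (a * s * t * b) := by
      have e1 : a * t * b = t * b := by rw [← hta.eq, mul_assoc, hab]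
      have e2 : a * s * a * t * b = a * s * t * b := by
        calc _ = a * s * (a * t * b) := by simp only [mul_assoc]
          _ = _ := by rw [e1]; simp only [mul_assoc]
      rw [mul_smul_comm, ← smul_mul_assoc, hb, sub_mul, sub_mul, smul_mul_assoc, smul_mul_assoc,
        e1, e2]
    rw [mul_sub, sub_mul, h1, mul_one, hbb]
    abel
  have h2 : t * (a * s * t * b) = -(a * s * t * b) := by
    calc t * (a * s * t * b) = (t * a) * s * t * b := by simp only [mul_assoc]
      _ = a * (t * s * t) * b := by rw [hta.eq]; simp only [mul_assoc]
      _ = a * s * t * (s * b) := by rw [← hst]; simp only [mul_assoc]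
      _ = _ := by rw [hsb]; simp only [mul_neg]
  rw [key, mul_add, mul_sub, mul_smul_comm, h2, ← mul_assoc t t b, ht, one_mul, smul_neg]
  abel

lemma antisymm_succ_mul (r : ℕ → E) (k : ℕ)
    (hid : antisymm r (k + 1) * antisymm r (k + 1) = antisymm r (k + 1)) :
    antisymm r (k + 1) * antisymm r (k + 2) = antisymm r (k + 2) ∧
      antisymm r (k + 2) * antisymm r (k + 1) = antisymm r (k + 2) := by
  constructor
  · rw [antisymm, mul_smul_comm, ← mul_assoc, ← mul_assoc, hid]
  · rw [antisymm, smul_mul_assoc, mul_assoc, hid]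

/-- Antisymmetrizers are idempotents on which the generators act by `-1`. -/
lemma antisymm_spec {r : ℕ → E} {p : ℕ} (hr : IsCoxeterFamily r p) :
    ∀ k, k ≤ p → (∀ i, i + 1 < k → r i * antisymm r k = -antisymm r k ∧
      antisymm r k * r i = -antisymm r k) ∧ antisymm r k * antisymm r k = antisymm r k := by
  intro k
  induction k using Nat.strong_induction_on with
  | _ k IH =>
  intro hk
  match k, IH, hk with
  | 0, _, _ => simp [antisymm]
  | 1, _, _ => simp [antisymm]
  | k + 2, IH, hk =>
    obtain ⟨hb1, hb2⟩ := IH (k + 1) (by omega) (by omega)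
    have hk2 : ((k : ℂ) + 2) ≠ 0 := by exact_mod_cast (Nat.succ_ne_zero (k + 1))
    have hlast : r k * antisymm r (k + 2) = -antisymm r (k + 2) ∧
        antisymm r (k + 2) * r k = -antisymm r (k + 2) := by
      rcases k with _ | k
      · have := hr.sq 0
        simp only [antisymm, one_mul, mul_one, mul_smul_comm, smul_mul_assoc, mul_sub, sub_mul,
          Nat.cast_zero, zero_add, one_smul, this, ← smul_neg, neg_sub, and_self]
      · obtain ⟨ha1, ha2⟩ := IH (k + 1) (by omega) (by omega)
        obtain ⟨hab, hba⟩ := antisymm_succ_mul r k ha2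
        have hk1 : ((k : ℂ) + 2) ≠ 0 := by exact_mod_cast (Nat.succ_ne_zero (k + 1))
        have hb : (((k + 1 : ℕ) : ℂ) + 1) • antisymm r (k + 2) = antisymm r (k + 1) -
            ((k + 1 : ℕ) : ℂ) • (antisymm r (k + 1) * r k * antisymm r (k + 1)) := by
          rw [antisymm, smul_smul]
          push_cast
          rw [show ((k : ℂ) + 1 + 1) * ((k : ℂ) + 2)⁻¹ = 1 by
            rw [add_assoc, one_add_one_eq_two, mul_inv_cancel₀ hk1], one_smul, mul_sub, sub_mul,
            mul_one, ha2, mul_smul_comm, smul_mul_assoc]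
        have hta : Commute (r (k + 1)) (antisymm r (k + 1)) :=
          antisymm_commute _ fun i hi => (hr.comm i (k + 1) (by omega)).symm
        obtain ⟨hsb, hbs⟩ := hb1 k (by omega)
        have hst := hr.braid k (by omega)
        constructor
        · have := antisymm_step_left hab hta hsb hb (hr.sq _) hst hb2
          conv_lhs => rw [antisymm]
          conv_rhs => rw [antisymm]
          rw [mul_smul_comm, this, smul_neg]
        · have := antisymm_step_right hba hta hbs hb (hr.sq _) hst hb2
          conv_lhs => rw [antisymm]
          conv_rhs => rw [antisymm]
          rw [smul_mul_assoc, this, smul_neg]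
    refine ⟨fun i hi => ?_, ?_⟩
    · rcases Nat.lt_or_ge (i + 1) (k + 1) with h | h
      · obtain ⟨h1, h2⟩ := hb1 i h
        constructor
        · rw [antisymm, mul_smul_comm, ← mul_assoc, ← mul_assoc, h1]
          simp only [neg_mul, smul_neg]
        · rw [antisymm, smul_mul_assoc, mul_assoc, h2]
          simp only [mul_neg, smul_neg]
      · obtain rfl : i = k := by omega
        exact hlast
    · have hcb := (antisymm_succ_mul r k hb2).2
      -- The larger antisymmetrizer absorbs the smaller one and turns `r k` into `-1`, so the middle
      -- factor contributes `1 + (k + 1)`; this is what the normalisation `(k + 2)⁻¹` cancels.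
      have : antisymm r (k + 2) * (antisymm r (k + 1) * (1 - ((k + 1 : ℂ)) • r k) *
          antisymm r (k + 1)) = ((k : ℂ) + 2) • antisymm r (k + 2) := by
        rw [← mul_assoc, ← mul_assoc, hcb, mul_sub, mul_one, mul_smul_comm, hlast.2, smul_neg,
          sub_neg_eq_add, add_mul, smul_mul_assoc, hcb]
        module
      nth_rewrite 2 [antisymm]
      rw [mul_smul_comm, this, smul_smul, inv_mul_cancel₀ hk2, one_smul]

/-- A vector on which the generators act by `-1` is fixed by the antisymmetrizer. -/
lemma antisymm_mulVec {n : Type*} [Fintype n] [DecidableEq n] {r : ℕ → Matrix n n ℂ} {f : n → ℂ}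
    (k : ℕ) (h : ∀ i, i + 1 < k → (r i).mulVec f = -f) : (antisymm r k).mulVec f = f := by
  induction k using skewSymm.induct with
  | case1 => simp [antisymm]
  | case2 => simp [antisymm]
  | case3 k ih =>
    have ih' := ih fun i hi => h i (by omega)
    have hk2 : ((k : ℂ) + 2) ≠ 0 := by exact_mod_cast (Nat.succ_ne_zero (k + 1))
    have h1 : (1 - ((k + 1 : ℂ)) • r k).mulVec f = ((k : ℂ) + 2) • f := by
      rw [Matrix.sub_mulVec, Matrix.smul_mulVec, h k (by omega), Matrix.one_mulVec]
      module
    rw [antisymm, Matrix.smul_mulVec, ← Matrix.mulVec_mulVec, ← Matrix.mulVec_mulVec, ih', h1,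
      Matrix.mulVec_smul, ih', smul_smul, inv_mul_cancel₀ hk2, one_smul]

end Antisymm

/-! ### Conjugated copies of an element -/

section Copies

variable {E : Type*} [Ring E]

/-- The product `r 0 * r 1 * ⋯ * r (k - 1)`. -/
def ascProd (r : ℕ → E) : ℕ → E
  | 0 => 1
  | k + 1 => ascProd r k * r k

/-- The product `r (k - 1) * ⋯ * r 1 * r 0`. -/
def descProd (r : ℕ → E) : ℕ → E
  | 0 => 1
  | k + 1 => r k * descProd r k

lemma ascProd_mul_descProd {r : ℕ → E} (h : ∀ i, r i * r i = 1) (k : ℕ) :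
    ascProd r k * descProd r k = 1 := by
  induction k with
  | zero => simp [ascProd, descProd]
  | succ k ih =>
    rw [ascProd, descProd, mul_assoc, ← mul_assoc (r k), h, one_mul, ih]

lemma commute_ascProd {r : ℕ → E} {x : E} {k : ℕ} (h : ∀ i, i < k → Commute x (r i)) :
    Commute x (ascProd r k) := by
  induction k with
  | zero => exact Commute.one_right x
  | succ k ih => exact (ih fun i hi => h i (by omega)).mul_right (h k (by omega))

/-- `r 0 ⋯ r (k - 1)` shifts the generators by one. -/
lemma ascProd_shift {r : ℕ → E} {p : ℕ} (hr : IsCoxeterFamily r p) {i k : ℕ} (hi : i + 1 < k)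
    (hk : k < p) : ascProd r k * r i = r (i + 1) * ascProd r k := by
  induction k with
  | zero => omega
  | succ k ih =>
    rcases Nat.lt_or_ge (i + 1) k with h | h
    · rw [ascProd, mul_assoc, ← (hr.comm i k (by omega)).eq, ← mul_assoc, ih h (by omega),
        mul_assoc]
    · obtain rfl : k = i + 1 := by omega
      have hc : Commute (r (i + 1)) (ascProd r i) :=
        commute_ascProd fun j hj => (hr.comm j (i + 1) (by omega)).symm
      rw [ascProd, ascProd]
      calc _ = ascProd r i * (r i * r (i + 1) * r i) := by simp only [mul_assoc]
        _ = ascProd r i * r (i + 1) * r i * r (i + 1) := by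
          rw [hr.braid i (by omega)]; simp only [mul_assoc]
        _ = _ := by rw [← hc.eq]; simp only [mul_assoc]

/-- The copies `x`, `r 0 * x * r 0`, `r 1 * r 0 * x * r 0 * r 1`, … of an element. -/
def conjCopy (r : ℕ → E) (x : E) : ℕ → E
  | 0 => x
  | k + 1 => r k * conjCopy r x k * r k

lemma conjCopy_eq (r : ℕ → E) (x : E) (k : ℕ) :
    conjCopy r x k = descProd r k * x * ascProd r k := by
  induction k with
  | zero => simp [conjCopy, descProd, ascProd]
  | succ k ih => rw [conjCopy, ih, descProd, ascProd]; simp only [mul_assoc]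

variable {r : ℕ → E} {p : ℕ} {x : E}

/-- Generators far from the last conjugating one pass through by induction. In the remaining case,
`r i` next to `r (i + 1) * r i` turns by the braid relation into `r (i + 1)` on the inner side, and
this commutes with the copy number `i`. -/
lemma commute_conjCopy (hr : IsCoxeterFamily r p) (hx : ∀ i, 1 ≤ i → Commute (r i) x) (k : ℕ)
    (hk : k < p) (i : ℕ) (h1 : i ≠ k) (h2 : i + 1 ≠ k) : Commute (r i) (conjCopy r x k) := by
  induction k using Nat.strong_induction_on generalizing i with
  | _ k IH =>
  rcases k with _ | k
  · exact hx i (by omega)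
  rcases Nat.lt_or_ge (i + 1) k with h | h
  · have hc := hr.comm i k (by omega)
    exact (hc.mul_right (IH k (by omega) (by omega) i (by omega) (by omega))).mul_right hc
  rcases Nat.lt_or_ge k i with h' | h'
  · have hc := (hr.comm k i (by omega)).symm
    exact (hc.mul_right (IH k (by omega) (by omega) i (by omega) (by omega))).mul_right hc
  obtain rfl : k = i + 1 := by omega
  have hc := IH i (by omega) (by omega) (i + 1) (by omega) (by omega)
  have hb := hr.braid i (by omega)
  rw [conjCopy, conjCopy]
  set y := conjCopy r x i
  calc r i * (r (i + 1) * (r i * y * r i) * r (i + 1))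
      = (r i * r (i + 1) * r i) * y * (r i * r (i + 1)) := by simp only [mul_assoc]
    _ = r (i + 1) * r i * (r (i + 1) * y) * (r i * r (i + 1)) := by
      rw [hb]; simp only [mul_assoc]
    _ = r (i + 1) * r i * y * (r (i + 1) * r i * r (i + 1)) := by
      rw [hc.eq]; simp only [mul_assoc]
    _ = _ := by rw [← hb]; simp only [mul_assoc]

/-- With `a = r k` and `b = r (k + 1)`, conjugation by `a * b` carries the pair `(a, y)` to `(b, a *
y * a)`: the first by the braid relation, the second because `b` commutes with `y`. The reflection
equation for one pair is thus conjugate to that for the next. -/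
lemma conjCopy_reflection (hr : IsCoxeterFamily r p) (hx : ∀ i, 1 ≤ i → Commute (r i) x)
    (h0 : r 0 * x * r 0 * x = x * r 0 * x * r 0) (k : ℕ) (hk : k + 1 < p) :
    r k * conjCopy r x k * r k * conjCopy r x k = conjCopy r x k * r k * conjCopy r x k * r k := by
  induction k with
  | zero => exact h0
  | succ k ih =>
    have ih' := ih (by omega)
    have hc := commute_conjCopy hr hx k (by omega) (k + 1) (by omega) (by omega)
    have hb := hr.braid k (by omega)
    have hs := hr.sq k
    have hs' := hr.sq (k + 1)
    rw [conjCopy]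
    set y := conjCopy r x k
    set a := r k
    set b := r (k + 1)
    have hab : (a * b) * (b * a) = 1 := by
      rw [mul_assoc, ← mul_assoc b, hs', one_mul, hs]
    have hba : (b * a) * (a * b) = 1 := by
      rw [mul_assoc, ← mul_assoc a, hs, one_mul, hs']
    have h1 : a * y * a = (a * b) * y * (b * a) := by
      calc a * y * a = a * (b * b) * y * a := by rw [hs', mul_one]
        _ = a * b * (b * y) * a := by simp only [mul_assoc]
        _ = _ := by rw [hc.eq]; simp only [mul_assoc]
    have h2 : b = (a * b) * a * (b * a) := by
      rw [hb]
      calc b = b * (a * (b * b) * a) := by rw [hs', mul_one, hs, mul_one]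
        _ = _ := by simp only [mul_assoc]
    have h3 : ∀ z w, ((a * b) * z * (b * a)) * ((a * b) * w * (b * a)) =
        (a * b) * (z * w) * (b * a) := fun z w => by
      calc _ = (a * b) * z * ((b * a) * (a * b)) * w * (b * a) := by simp only [mul_assoc]
        _ = _ := by rw [hba, mul_one]; simp only [mul_assoc]
    rw [h1]
    rw [show ∀ z : E, b * z * b * z = ((a * b) * a * (b * a)) * z * ((a * b) * a * (b * a)) * z
      from fun z => by rw [← h2], show ∀ z : E, z * b * z * b =
        z * ((a * b) * a * (b * a)) * z * ((a * b) * a * (b * a)) from fun z => by rw [← h2]]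
    simp only [h3, ih']

/-- The ordered product of the first `k` copies. -/
def copyProd (r : ℕ → E) (x : E) (k : ℕ) : E := ((List.range k).map (conjCopy r x)).prod

lemma copyProd_succ (r : ℕ → E) (x : E) (k : ℕ) :
    copyProd r x (k + 1) = copyProd r x k * conjCopy r x k := by
  simp [copyProd, List.range_succ]

/-- `r i` commutes with each copy other than numbers `i` and `i + 1`, and by the reflection equation
with the product of these two. The excluded index is the one where the product contains the first of
them but not the second. -/
lemma commute_copyProd (hr : IsCoxeterFamily r p) (hx : ∀ i, 1 ≤ i → Commute (r i) x)
    (h0 : r 0 * x * r 0 * x = x * r 0 * x * r 0) (k : ℕ) (hk : k ≤ p) (i : ℕ)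
    (hi : i + 1 ≠ k) : Commute (r i) (copyProd r x k) := by
  induction k using Nat.strong_induction_on with
  | _ k IH =>
  rcases k with _ | k
  · exact Commute.one_right _
  rw [copyProd_succ]
  by_cases h : i + 1 = k
  · subst h
    rw [copyProd_succ, mul_assoc]
    refine (IH i (by omega) (by omega) (by omega)).mul_right ?_
    have := conjCopy_reflection hr hx h0 i (by omega)
    have hs := hr.sq i
    rw [conjCopy]
    set y := conjCopy r x i
    change r i * (y * (r i * y * r i)) = y * (r i * y * r i) * r i
    calc _ = (r i * y * r i * y) * r i := by simp only [mul_assoc]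
      _ = _ := by rw [this]; simp only [mul_assoc]
  · exact (IH k (by omega) (by omega) h).mul_right
      (commute_conjCopy hr hx k (by omega) i (by omega) h)

/-- The last factor of the product of copies ends with `x`, up to generators. -/
lemma copyProd_succ_mul_descProd (hr : IsCoxeterFamily r p) (k : ℕ) :
    copyProd r x (k + 1) * descProd r k = copyProd r x k * descProd r k * x := by
  rw [copyProd_succ, conjCopy_eq]
  calc _ = copyProd r x k * descProd r k * x * (ascProd r k * descProd r k) := by
        simp only [mul_assoc]
    _ = _ := by rw [ascProd_mul_descProd hr.sq, mul_one]

/-- The reflection equation is preserved by the shift by a central element. -/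
lemma reflection_sub_central {a τ : E} (ha : a * a = 1) (h0 : a * x * a * x = x * a * x * a)
    (hτ : ∀ z, Commute τ z) :
    a * (x - τ) * a * (x - τ) = (x - τ) * a * (x - τ) * a := by
  have h1 : a * (x - τ) * a = a * x * a - τ := by
    rw [mul_sub, sub_mul, ← (hτ a).eq, mul_assoc τ, ha, mul_one]
  -- The reflection equation says that `x` commutes with `a * x * a`; a central shift of both does
  -- not affect this.
  have h2 : (x - τ) * (a * x * a - τ) = (a * x * a - τ) * (x - τ) := by
    rw [sub_mul, sub_mul, mul_sub, mul_sub, mul_sub, mul_sub, ← (hτ x).eq, (hτ (a * x * a)).eq,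
      h0, show x * (a * x * a) = x * a * x * a by simp only [mul_assoc]]
    abel
  rw [h1, ← h2, ← h1]
  simp only [mul_assoc]

end Copies

/-! ### Operators acting in selected tensor factors -/

section Embed

variable {N p q s : ℕ} {A : Type*}

/-- The operator `M` on `V^{⊗ q}` acting in the factors `e 0, …, e (q - 1)` of `V^{⊗ p}`. -/
def embed [Zero A] (e : Fin q → Fin p) (M : MatT N q A) : MatT N p A := fun i j =>
  if ∀ l, (∀ a, e a ≠ l) → i l = j l then M (i ∘ e) (j ∘ e) else 0

/-- A nonzero term forces the intermediate multi-index to agree with `i` off the image of `e`, so it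
is `Function.extend e κ i` for a unique `κ`. -/
lemma embed_mul [Semiring A] {e : Fin q → Fin p} (he : Function.Injective e)
    (M M' : MatT N q A) : embed e (M * M') = embed e M * embed e M' := by
  ext i j
  rw [Matrix.mul_apply]
  simp only [embed]
  split_ifs with h
  · rw [Matrix.mul_apply]
    refine Finset.sum_of_injOn (fun κ => Function.extend e κ i) ?_ (by simp) ?_ ?_
    · intro κ _ κ' _ hκ
      ext a
      have := congrFun hκ (e a)
      simp only [he.extend_apply] at this
      rw [this]
    · intro k _ hk
      rw [if_neg, zero_mul]
      intro hik
      refine hk ⟨k ∘ e, by simp, ?_⟩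
      ext l
      by_cases hl : ∃ a, e a = l
      · obtain ⟨a, rfl⟩ := hl
        simp [he.extend_apply]
      · simp only
        rw [Function.extend_apply' _ _ _ hl, hik l (by simpa using hl)]
    · intro κ _
      have hcomp : (Function.extend e κ i) ∘ e = κ := Function.extend_comp he κ i
      have hoff : ∀ l, (∀ a, e a ≠ l) → Function.extend e κ i l = i l := fun l hl =>
        Function.extend_apply' _ _ _ (by simpa using hl)
      rw [if_pos fun l hl => (hoff l hl).symm, if_pos fun l hl => (hoff l hl).trans (h l hl),
        hcomp]
  · refine (Finset.sum_eq_zero fun k _ => ?_).symm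
    by_cases h1 : ∀ l, (∀ a, e a ≠ l) → i l = k l
    · rw [if_neg (c := ∀ l, (∀ a, e a ≠ l) → k l = j l), mul_zero]
      exact fun h2 => h fun l hl => (h1 l hl).trans (h2 l hl)
    · rw [if_neg h1, zero_mul]

lemma embed_one [Semiring A] (e : Fin q → Fin p) : embed e (1 : MatT N q A) = 1 := by
  ext i j
  simp only [embed, Matrix.one_apply]
  by_cases hij : i = j
  · simp [hij]
  · rw [if_neg hij, ite_eq_right_iff]
    intro h
    rw [if_neg]
    intro h'
    refine hij (funext fun l => ?_)
    by_cases hl : ∃ a, e a = l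
    · obtain ⟨a, rfl⟩ := hl
      exact congrFun h' a
    · exact h l (by simpa using hl)

/-- `embed` as an algebra homomorphism. -/
def embedHom [Ring A] [Algebra ℂ A] (e : Fin q → Fin p) (he : Function.Injective e) :
    MatT N q A →ₐ[ℂ] MatT N p A :=
  AlgHom.ofLinearMap
    { toFun := embed e
      map_add' := fun M M' => by
        ext i j
        simp only [embed, Matrix.add_apply]
        split_ifs <;> simp
      map_smul' := fun c M => by
        ext i j
        simp only [embed, Matrix.smul_apply, RingHom.id_apply]
        split_ifs <;> simp }
    (embed_one e) (embed_mul he)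

@[simp]
lemma embedHom_apply [Ring A] [Algebra ℂ A] (e : Fin q → Fin p) (he : Function.Injective e)
    (M : MatT N q A) : embedHom e he M = embed e M := rfl

lemma embed_embed [Zero A] {e : Fin q → Fin p} (he : Function.Injective e) (e' : Fin s → Fin q)
    (M : MatT N s A) : embed e (embed e' M) = embed (e ∘ e') M := by
  ext i j
  simp only [embed, Function.comp_apply]
  by_cases h : ∀ l, (∀ a, e (e' a) ≠ l) → i l = j l
  · rw [if_pos h, if_pos, if_pos]
    · rfl
    · intro l hl
      exact h (e l) fun a ha => hl a (he ha)
    · exact fun l hl => h l fun a => hl (e' a)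
  · rw [if_neg h]
    by_cases h1 : ∀ l, (∀ a, e a ≠ l) → i l = j l
    · rw [if_pos h1, if_neg]
      intro h2
      refine h fun l hl => ?_
      by_cases hl' : ∃ a, e a = l
      · obtain ⟨a, rfl⟩ := hl'
        exact h2 a fun b hb => hl b (by rw [hb])
      · exact h1 l (by simpa using hl')
    · rw [if_neg h1]

lemma embed_mul_embed_apply [Semiring A] {e : Fin q → Fin p} {e' : Fin s → Fin p}
    (hee : ∀ a b, e a ≠ e' b) (M : MatT N q A) (M' : MatT N s A) (i j : Fin p → Fin N) :
    (embed e M * embed e' M') i j =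
      if ∀ l, (∀ a, e a ≠ l) → (∀ b, e' b ≠ l) → i l = j l then
        M (i ∘ e) (j ∘ e) * M' (i ∘ e') (j ∘ e') else 0 := by
  classical
  rw [Matrix.mul_apply]
  -- The only intermediate multi-index with a nonzero contribution: the first operator has already
  -- replaced `i` by `j` on the image of `e`, and nowhere else.
  set k₀ : Fin p → Fin N := fun l => if ∃ a, e a = l then j l else i l with hk₀
  have hk₀e : ∀ a, k₀ (e a) = j (e a) := fun a => if_pos ⟨a, rfl⟩
  have hk₀e' : ∀ l, (∀ a, e a ≠ l) → k₀ l = i l := fun l hl => if_neg (by simpa using hl)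
  rw [Finset.sum_eq_single k₀]
  · simp only [embed]
    rw [if_pos fun l hl => (hk₀e' l hl).symm]
    have hc1 : k₀ ∘ e = j ∘ e := funext hk₀e
    have hc2 : k₀ ∘ e' = i ∘ e' := funext fun b => hk₀e' _ fun a => hee a b
    rw [hc1, hc2]
    by_cases h : ∀ l, (∀ a, e a ≠ l) → (∀ b, e' b ≠ l) → i l = j l
    · rw [if_pos h, if_pos]
      intro l hl
      by_cases hl' : ∃ a, e a = l
      · obtain ⟨a, rfl⟩ := hl'
        exact hk₀e a
      · have hl'' : ∀ a, e a ≠ l := by simpa using hl'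
        exact (hk₀e' l hl'').trans (h l hl'' hl)
    · rw [if_neg h, if_neg, mul_zero]
      exact fun h' => h fun l hl hl' => (hk₀e' l hl).symm.trans (h' l hl')
  · intro k _ hk
    simp only [embed]
    by_cases h1 : ∀ l, (∀ a, e a ≠ l) → i l = k l
    · rw [if_neg (c := ∀ l, (∀ a, e' a ≠ l) → k l = j l), mul_zero]
      intro h2
      refine hk (funext fun l => ?_)
      by_cases hl' : ∃ a, e a = l
      · obtain ⟨a, rfl⟩ := hl'
        rw [hk₀e, h2 _ fun b => (hee a b).symm]
      · have hl'' : ∀ a, e a ≠ l := by simpa using hl'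
        rw [hk₀e' l hl'', h1 l hl'']
    · rw [if_neg h1, zero_mul]
  · simp

/-- Operators with commuting entries acting in disjoint factors commute. -/
lemma commute_embed [Semiring A] {e : Fin q → Fin p} {e' : Fin s → Fin p}
    (hee : ∀ a b, e a ≠ e' b) {M : MatT N q A} {M' : MatT N s A}
    (hM : ∀ a b c d, Commute (M a b) (M' c d)) : Commute (embed e M) (embed e' M') := by
  ext i j
  rw [embed_mul_embed_apply hee, embed_mul_embed_apply fun a b => (hee b a).symm,
    (hM _ _ _ _).eq]
  exact if_congr ⟨fun h l h1 h2 => h l h2 h1, fun h l h1 h2 => h l h2 h1⟩ rfl rfl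

lemma embed_map [Zero A] {B : Type*} [Zero B] (e : Fin q → Fin p) (M : MatT N q A) (f : A → B)
    (hf : f 0 = 0) : (embed e M).map f = embed e (M.map f) := by
  ext i j
  simp only [embed, Matrix.map_apply]
  split_ifs <;> simp [hf]

/-- `R` as an operator on `V^{⊗ 2}` indexed by functions. -/
def toTwo (R : Op2 N) : MatT N 2 ℂ := fun i j => R (i 0, i 1) (j 0, j 1)

lemma toTwo_mul (R S : Op2 N) : toTwo (R * S) = toTwo R * toTwo S := by
  ext i j
  simp only [toTwo, Matrix.mul_apply]
  exact (Equiv.sum_comp (finTwoArrowEquiv (Fin N))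
    fun k => R (i 0, i 1) k * S k (j 0, j 1)).symm

lemma toTwo_one : toTwo (1 : Op2 N) = 1 := by
  ext i j
  simp only [toTwo, Matrix.one_apply, Prod.mk.injEq]
  refine if_congr ⟨fun h => funext fun a => ?_, fun h => by simp [h]⟩ rfl rfl
  fin_cases a
  · exact h.1
  · exact h.2

/-- The inclusion of the factors `k` and `k + 1`. -/
def pairAt {p k : ℕ} (h : k + 1 < p) : Fin 2 → Fin p := ![⟨k, by omega⟩, ⟨k + 1, h⟩]

lemma pairAt_injective {k : ℕ} (h : k + 1 < p) : Function.Injective (pairAt h) := by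
  intro a b hab
  fin_cases a <;> fin_cases b <;> simp_all [pairAt]

lemma site2_eq_embed (R : Op2 N) {k : ℕ} (h : k + 1 < p) :
    site2 R p k = embed (pairAt h) (toTwo R) := by
  ext i j
  simp only [site2, h, dif_pos, embed]
  refine if_congr ⟨fun H l hl => ?_, fun H l h1 h2 => ?_⟩ rfl rfl
  · refine H l (fun h' => hl 0 (Fin.ext h'.symm)) (fun h' => hl 1 (Fin.ext h'.symm))
  · refine H l fun a => ?_
    fin_cases a
    · exact fun h' => h1 (by rw [← h']; rfl)
    · exact fun h' => h2 (by rw [← h']; rfl)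

lemma site2_of_le (R : Op2 N) {k : ℕ} (h : p ≤ k + 1) : site2 R p k = 1 := by
  ext i j
  simp [site2, Nat.not_lt.2 h]

lemma embed_site2 (R : Op2 N) {e : Fin q → Fin p} (he : Function.Injective e) {k k' : ℕ}
    (h : k + 1 < q) (h' : k' + 1 < p) (h0 : (e ⟨k, by omega⟩ : ℕ) = k')
    (h1 : (e ⟨k + 1, h⟩ : ℕ) = k' + 1) : embed e (site2 R q k) = site2 R p k' := by
  rw [site2_eq_embed R h, site2_eq_embed R h', embed_embed he]
  congr 1
  ext a
  fin_cases a
  · exact h0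
  · exact h1

lemma site2_mul_self {R : Op2 N} (hR : R * R = 1) (p k : ℕ) :
    site2 R p k * site2 R p k = 1 := by
  by_cases h : k + 1 < p
  · rw [site2_eq_embed R h, ← embed_mul (pairAt_injective h), ← toTwo_mul, hR, toTwo_one, embed_one]
  · rw [site2_of_le R (by omega), one_mul]

/-- An involutive symmetry represents the symmetric group on tensor powers. -/
lemma isCoxeterFamily_site2 {R : Op2 N} (hR : IsInvolutiveSymmetry R) (p : ℕ) :
    IsCoxeterFamily (site2 R p) p where
  sq := site2_mul_self hR.sq_eq_one p
  braid i hi := by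
    -- The relation on `V^{⊗ 3}` is transported to the factors `i`, `i + 1`, `i + 2`.
    have he : Function.Injective fun l : Fin 3 => (⟨i + l, by omega⟩ : Fin p) := by
      intro a b hab
      simpa [Fin.ext_iff] using hab
    have h0 := embed_site2 R he (k := 0) (k' := i) (by omega) (by omega) rfl rfl
    have h1 := embed_site2 R he (k := 1) (k' := i + 1) (by omega) (by omega) rfl rfl
    have := congrArg (embed fun l : Fin 3 => (⟨i + l, by omega⟩ : Fin p)) hR.braid
    simpa only [embed_mul he, h0, h1] using this
  comm i j hij := by
    by_cases hj : j + 1 < p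
    · rw [site2_eq_embed R hj, site2_eq_embed R (show i + 1 < p by omega)]
      refine commute_embed (fun a b => ?_) fun _ _ _ _ => Commute.all _ _
      fin_cases a <;> fin_cases b <;> simp [pairAt, Fin.ext_iff] <;> omega
    -- Out of range the operator is `1` by default, so the far commutation needs no bound on `j`.
    · rw [site2_of_le R (show p ≤ j + 1 by omega)]
      exact Commute.one_right _

/-- `X` as an operator on `V^{⊗ 1}` indexed by functions. -/
def toOne (X : Matrix (Fin N) (Fin N) A) : MatT N 1 A := fun i j => X (i 0) (j 0)

lemma site1_eq_embed [Ring A] (X : Matrix (Fin N) (Fin N) A) (h : 0 < p) :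
    site1 X p = embed (fun _ => ⟨0, h⟩) (toOne X) := by
  ext i j
  simp only [site1, h, dif_pos, embed]
  refine if_congr ⟨fun H l hl => ?_, fun H l h1 => ?_⟩ rfl rfl
  · exact H l fun h' => hl 0 (Fin.ext h'.symm)
  · exact H l fun a h' => h1 (by rw [← h'])

end Embed

/-! ### Copies of a matrix -/

section Scal

variable {N p : ℕ} {A : Type*} [Ring A] [Algebra ℂ A]

/-- `scal` as an algebra homomorphism. -/
def scalHom (N p : ℕ) (A : Type*) [Ring A] [Algebra ℂ A] : MatT N p ℂ →ₐ[ℂ] MatT N p A :=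
  (Algebra.ofId ℂ A).mapMatrix

lemma scalHom_apply (M : MatT N p ℂ) : scalHom N p A M = scal A M := rfl

lemma isCoxeterFamily_scal {R : Op2 N} (hR : IsInvolutiveSymmetry R) (A : Type*) [Ring A]
    [Algebra ℂ A] (p : ℕ) : IsCoxeterFamily (fun i => scal A (site2 R p i)) p where
  sq i := by
    simp only [← scalHom_apply, ← map_mul, (isCoxeterFamily_site2 hR p).sq, map_one]
  braid i hi := by
    simp only [← scalHom_apply, ← map_mul, (isCoxeterFamily_site2 hR p).braid i hi]
  comm i j hij := by
    simp only [← scalHom_apply]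
    exact ((isCoxeterFamily_site2 hR p).comm i j hij).map (scalHom N p A)

lemma copy_eq_conjCopy {R : Op2 N} (hR : R * R = 1) (X : Matrix (Fin N) (Fin N) A) (p k : ℕ) :
    copy R X p k = conjCopy (fun i => scal A (site2 R p i)) (site1 X p) k := by
  induction k with
  | zero => rfl
  | succ k ih => rw [copy, conjCopy, ih, Matrix.inv_eq_left_inv hR]

lemma commute_scal_site1 (R : Op2 N) (X : Matrix (Fin N) (Fin N) A) (i : ℕ) (hi : 1 ≤ i) :
    Commute (scal A (site2 R p i)) (site1 X p) := by
  by_cases h : i + 1 < p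
  · rw [site2_eq_embed R h, site1_eq_embed X (show 0 < p by omega), scal,
      embed_map _ _ _ (map_zero _)]
    refine commute_embed (fun a b => ?_) fun _ _ _ _ => Algebra.commutes _ _
    fin_cases a <;> simp [pairAt, Fin.ext_iff]; omega
  · rw [site2_of_le R (by omega), ← scalHom_apply, map_one]
    exact Commute.one_left _

/-- The reflection equation carries over from `V^{⊗ 2}` to higher tensor powers. -/
lemma reflection_of_two {R : Op2 N} (hR : R * R = 1) {X : Matrix (Fin N) (Fin N) A}
    (h : scal A (site2 R 2 0) * copy R X 2 0 * copy R X 2 1 =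
      copy R X 2 0 * copy R X 2 1 * scal A (site2 R 2 0)) (hp : 2 ≤ p) :
    scal A (site2 R p 0) * site1 X p * scal A (site2 R p 0) * site1 X p =
      site1 X p * scal A (site2 R p 0) * site1 X p * scal A (site2 R p 0) := by
  have he : Function.Injective (Fin.castLE hp) := Fin.castLE_injective hp
  have h2 : embed (Fin.castLE hp) (scal A (site2 R 2 0)) = scal A (site2 R p 0) := by
    rw [scal, ← embed_map _ _ _ (map_zero _), embed_site2 R he (by omega) (by omega) rfl rfl, scal]
  have h1 : embed (Fin.castLE hp) (site1 X 2) = site1 X p := by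
    rw [site1_eq_embed X (by omega), site1_eq_embed X (by omega), embed_embed he]
    rfl
  have hs : scal A (site2 R p 0) * scal A (site2 R p 0) = 1 := by
    simp only [← scalHom_apply, ← map_mul, site2_mul_self hR, map_one]
  -- With `R⁻¹ = R` the relation becomes `r x (r x r) = x (r x r) r`, which is the reflection
  -- equation up to `r² = 1`.
  have := congrArg (embed (Fin.castLE hp)) h
  simp only [copy, Matrix.inv_eq_left_inv hR, embed_mul he, h1, h2] at this
  set r := scal A (site2 R p 0)
  set x := site1 X p
  calc r * x * r * x = r * x * (r * x * r) * r := by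
        simp only [mul_assoc, hs, mul_one]
    _ = x * (r * x * (r * r)) * r := by rw [this]; simp only [mul_assoc]
    _ = _ := by rw [hs, mul_one]; simp only [mul_assoc]

end Scal

/-! ### Words in the `R`-skew-symmetric algebra -/

section Words

variable {N : ℕ}

lemma embed_mulVec {p q : ℕ} {e : Fin q → Fin p} (he : Function.Injective e) (M : MatT N q ℂ)
    (f : (Fin p → Fin N) → ℂ) (i : Fin p → Fin N) :
    (embed e M).mulVec f i = ∑ κ, M (i ∘ e) κ * f (Function.extend e κ i) := by
  symm
  refine Finset.sum_of_injOn (fun κ => Function.extend e κ i) ?_ (by simp) ?_ ?_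
  · intro κ _ κ' _ hκ
    ext a
    have := congrFun hκ (e a)
    simp only [he.extend_apply] at this
    rw [this]
  · intro k _ hk
    simp only [embed]
    rw [if_neg, zero_mul]
    intro hik
    refine hk ⟨k ∘ e, by simp, ?_⟩
    ext l
    by_cases hl : ∃ a, e a = l
    · obtain ⟨a, rfl⟩ := hl
      simp [he.extend_apply]
    · simp only
      rw [Function.extend_apply' _ _ _ hl, hik l (by simpa using hl)]
  · intro κ _
    simp only [embed]
    rw [if_pos, Function.extend_comp he κ i]
    intro l hl
    rw [Function.extend_apply' _ _ _ (by simpa using hl)]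

/-- Translates the action of `R` in two adjacent factors into a substitution of two letters inside a
list, the form in which the relations of `Λ_R(V)` are stated. -/
lemma ofFn_extend_pairAt {p k : ℕ} (h : k + 1 < p) (a b : Fin N) (w : Fin p → Fin N) :
    List.ofFn (Function.extend (pairAt h) ![a, b] w) =
      (List.ofFn w).take k ++ [a, b] ++ (List.ofFn w).drop (k + 2) := by
  have hinj := pairAt_injective h
  refine List.ext_getElem (by simp; omega) fun n h1 h2 => ?_
  rw [List.length_ofFn] at h1
  rw [List.getElem_ofFn]
  by_cases hk : n = k
  · subst hk
    have := hinj.extend_apply ![a, b] w 0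
    refine Eq.trans this ?_
    simp [show n - min n p = 0 by omega]
  by_cases hk' : n = k + 1
  · subst hk'
    have := hinj.extend_apply ![a, b] w 1
    refine Eq.trans this ?_
    simp [Nat.min_eq_left (show k ≤ p by omega)]
  rw [Function.extend_apply']
  · simp only [List.append_assoc, List.getElem_append, List.length_take, List.length_ofFn,
      List.getElem_take, List.getElem_ofFn, List.getElem_drop, List.length_cons, List.length_nil]
    split_ifs with h3 h4
    · rfl
    · omega
    · congr 2
      omega
  · rintro ⟨c, hc⟩
    fin_cases c
    · exact hk (congrArg Fin.val hc).symm
    · exact hk' (congrArg Fin.val hc).symm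

lemma site2_mulVec (R : Op2 N) {p k : ℕ} (h : k + 1 < p) (f : (Fin p → Fin N) → ℂ)
    (w : Fin p → Fin N) : (site2 R p k).mulVec f w =
      ∑ a, ∑ b, R (w ⟨k, by omega⟩, w ⟨k + 1, h⟩) (a, b) *
        f (Function.extend (pairAt h) ![a, b] w) := by
  rw [site2_eq_embed R h, embed_mulVec (pairAt_injective h), ← Fintype.sum_prod_type',
    ← Equiv.sum_comp (finTwoArrowEquiv (Fin N)).symm]
  rfl

/-- The functions on words on which `R` acts by `-1` in all places. -/
def antisymmFunctions (R : Op2 N) : Submodule ℂ (List (Fin N) → ℂ) where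
  carrier := {g | ∀ l r i j,
    g (l ++ [i, j] ++ r) + ∑ a, ∑ b, R (i, j) (a, b) * g (l ++ [a, b] ++ r) = 0}
  add_mem' {g g'} hg hg' l r i j := by
    have := congrArg₂ (· + ·) (hg l r i j) (hg' l r i j)
    simp only [Pi.add_apply, mul_add, Finset.sum_add_distrib] at this ⊢
    linear_combination this
  zero_mem' l r i j := by simp
  smul_mem' c g hg l r i j := by
    have := congrArg (c * ·) (hg l r i j)
    simp only [Pi.smul_apply, smul_eq_mul, mul_add, Finset.mul_sum, mul_zero] at this ⊢
    rw [← this]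
    simp only [mul_left_comm]

/-- Appending a letter to the argument of a function on words. -/
def appendLetter (R : Op2 N) (i : Fin N) : Module.End ℂ (antisymmFunctions R) where
  toFun g := ⟨fun l => g.1 (l ++ [i]), fun l r a b => by
    simpa only [List.append_assoc] using g.2 l (r ++ [i]) a b⟩
  map_add' _ _ := rfl
  map_smul' _ _ := rfl

lemma appendLetter_apply (R : Op2 N) (i : Fin N) (g : antisymmFunctions R) (l : List (Fin N)) :
    (appendLetter R i g).1 l = g.1 (l ++ [i]) := rfl

/-- The action of `Λ_R(V)` on functions on words. -/
def skewAction (R : Op2 N) : SkewAlg R →ₐ[ℂ] Module.End ℂ (antisymmFunctions R) :=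
  RingQuot.liftAlgHom ℂ ⟨FreeAlgebra.lift ℂ (appendLetter R), by
    rintro _ _ ⟨i, j, rfl, rfl⟩
    simp only [map_add, map_mul, map_sum, map_smul, FreeAlgebra.lift_ι_apply, map_zero]
    ext g l
    have := g.2 l [] i j
    simp only [List.append_nil] at this
    simp only [LinearMap.add_apply, LinearMap.sum_apply, LinearMap.smul_apply, Module.End.mul_apply,
      Submodule.coe_add, Submodule.coe_sum, Submodule.coe_smul, Pi.add_apply, Finset.sum_apply,
      Pi.smul_apply, smul_eq_mul, appendLetter_apply, List.append_assoc, List.cons_append,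
      List.nil_append, LinearMap.zero_apply, Submodule.coe_zero, Pi.zero_apply]
    exact this⟩

lemma skewAction_gen (R : Op2 N) (i : Fin N) :
    skewAction R (SkewAlg.gen R i) = appendLetter R i := by
  simp [skewAction, SkewAlg.gen]

/-- The leftmost letter acts last, hence is appended first. At `l = []` the action recovers the
value of `g` at the word. -/
lemma skewAction_word (R : Op2 N) (w l : List (Fin N)) (g : antisymmFunctions R) :
    (skewAction R (w.map (SkewAlg.gen R)).prod g).1 l = g.1 (l ++ w) := by
  induction w generalizing l with
  | nil => simp
  | cons i w ih =>
    rw [List.map_cons, List.prod_cons, map_mul, Module.End.mul_apply, skewAction_gen,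
      appendLetter_apply, ih, List.append_assoc, List.singleton_append]

/-- The product of the generators along a word. -/
def SkewAlg.word (R : Op2 N) {k : ℕ} (w : Fin k → Fin N) : SkewAlg R :=
  (List.ofFn fun a => SkewAlg.gen R (w a)).prod

lemma SkewAlg.word_eq (R : Op2 N) {k : ℕ} (w : Fin k → Fin N) :
    SkewAlg.word R w = ((List.ofFn w).map (SkewAlg.gen R)).prod := by
  rw [SkewAlg.word, List.map_ofFn]
  rfl

/-- An antisymmetric tensor defines a linear functional on `Λ_R(V)`. -/
lemma exists_functional (R : Op2 N) {k : ℕ} {f : (Fin k → Fin N) → ℂ}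
    (hf : ∀ i, i + 1 < k → (site2 R k i).mulVec f = -f) :
    ∃ φ : SkewAlg R →ₗ[ℂ] ℂ, ∀ w : Fin k → Fin N, φ (SkewAlg.word R w) = f w := by
  -- Extension of `f` by zero to words of other lengths; the antisymmetry condition is homogeneous
  -- in the length.
  set g : List (Fin N) → ℂ := fun L =>
    if h : L.length = k then f (fun x => L[x]) else 0 with hg
  have hgw : ∀ w : Fin k → Fin N, g (List.ofFn w) = f w := by
    intro w
    simp only [hg, List.length_ofFn, dif_pos, Fin.getElem_fin, List.getElem_ofFn]
  have hmem : g ∈ antisymmFunctions R := by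
    intro l r i j
    by_cases hlen : (l ++ [i, j] ++ r).length = k
    · obtain ⟨w, hw⟩ : ∃ w : Fin k → Fin N, List.ofFn w = l ++ [i, j] ++ r := by
        subst hlen
        exact ⟨fun x => (l ++ [i, j] ++ r)[x], List.ofFn_getElem⟩
      have hl : l.length + 1 < k := by
        simp only [List.length_append, List.length_cons, List.length_nil] at hlen
        omega
      have htake : (List.ofFn w).take l.length = l := by simp [hw]
      have hdrop : (List.ofFn w).drop (l.length + 2) = r := by
        rw [hw]
        exact List.drop_left' (by simp)
      have hi : w ⟨l.length, by omega⟩ = i := by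
        have : (List.ofFn w)[l.length]'(by simp; omega) = i := by simp [hw]
        simpa using this
      have hj : w ⟨l.length + 1, hl⟩ = j := by
        have : (List.ofFn w)[l.length + 1]'(by simp; omega) = j := by simp [hw]
        simpa using this
      have h1 := congrFun (hf l.length hl) w
      rw [site2_mulVec R hl, hi, hj] at h1
      simp only [← hgw, ofFn_extend_pairAt, htake, hdrop, Pi.neg_apply] at h1
      rw [h1, hw, add_neg_cancel]
    · have h0 : ∀ a b, g (l ++ [a, b] ++ r) = 0 := fun a b => dif_neg (by simpa using hlen)
      simp [h0, -List.append_assoc]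
  -- The functional sends `x` to the value of `x · g` at the empty word.
  refine ⟨LinearMap.proj [] ∘ₗ (antisymmFunctions R).subtype ∘ₗ
    LinearMap.applyₗ (⟨g, hmem⟩ : antisymmFunctions R) ∘ₗ (skewAction R).toLinearMap, fun w => ?_⟩
  rw [SkewAlg.word_eq, ← hgw]
  exact skewAction_word R (List.ofFn w) [] ⟨g, hmem⟩

lemma gen_relation (R : Op2 N) (i j : Fin N) : SkewAlg.gen R i * SkewAlg.gen R j +
    ∑ a, ∑ b, R (i, j) (a, b) • (SkewAlg.gen R a * SkewAlg.gen R b) = 0 := by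
  have := RingQuot.mkAlgHom_rel ℂ (s := skewRel R) ⟨i, j, rfl, rfl⟩
  simp only [map_add, map_mul, map_sum, map_smul, map_zero] at this
  exact this

/-- Linear functionals on `Λ_R(V)` are antisymmetric tensors. -/
lemma site2_mulVec_functional (R : Op2 N) {k i : ℕ} (hi : i + 1 < k) (φ : SkewAlg R →ₗ[ℂ] ℂ) :
    (site2 R k i).mulVec (fun w => φ (SkewAlg.word R w)) = -fun w => φ (SkewAlg.word R w) := by
  ext w
  rw [site2_mulVec R hi]
  have hw : List.ofFn w = (List.ofFn w).take i ++ [w ⟨i, by omega⟩, w ⟨i + 1, hi⟩] ++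
      (List.ofFn w).drop (i + 2) := by
    rw [← ofFn_extend_pairAt hi]
    congr 1
    ext x
    by_cases hx : ∃ a, pairAt hi a = x
    · obtain ⟨a, rfl⟩ := hx
      rw [(pairAt_injective hi).extend_apply]
      fin_cases a <;> rfl
    · rw [Function.extend_apply' _ _ _ hx]
  simp only [SkewAlg.word_eq, ofFn_extend_pairAt, Pi.neg_apply]
  conv_rhs => rw [hw]
  refine eq_neg_of_add_eq_zero_right ?_
  set x := (((List.ofFn w).take i).map (SkewAlg.gen R)).prod with hx
  set y := (((List.ofFn w).drop (i + 2)).map (SkewAlg.gen R)).prod with hy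
  have := congrArg (fun z => φ (x * z * y)) (gen_relation R (w ⟨i, by omega⟩) (w ⟨i + 1, hi⟩))
  simp only [mul_add, add_mul, Finset.mul_sum, Finset.sum_mul, map_add, map_sum, mul_smul_comm,
    smul_mul_assoc, map_smul, smul_eq_mul, mul_zero, zero_mul, map_zero] at this
  simp only [List.map_append, List.prod_append, List.map_cons, List.map_nil, List.prod_cons,
    List.prod_nil, mul_one, ← hx, ← hy]
  exact this

lemma eq_zero_of_forall_dual {W : Type*} [AddCommMonoid W] [Module ℂ W] {x : W}
    (h : ∀ φ : W →ₗ[ℂ] ℂ, φ x = 0) : x = 0 := by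
  let := Module.addCommMonoidToAddCommGroup ℂ (M := W)
  exact (Module.forall_dual_apply_eq_zero_iff ℂ x).1 h

lemma exists_generator_of_finrank {W : Type*} [AddCommMonoid W] [Module ℂ W]
    (h : Module.finrank ℂ W = 1) : ∃ e : W, ∀ x, ∃ c : ℂ, c • e = x := by
  let := Module.addCommMonoidToAddCommGroup ℂ (M := W)
  obtain ⟨e, -, he⟩ := finrank_eq_one_iff'.1 h
  exact ⟨e, he⟩

lemma skewSymm_spec {R : Op2 N} (hR : IsInvolutiveSymmetry R) {p k : ℕ} (hk : k ≤ p) :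
    (∀ i, i + 1 < k → site2 R p i * skewSymm R p k = -skewSymm R p k ∧
      skewSymm R p k * site2 R p i = -skewSymm R p k) ∧
      skewSymm R p k * skewSymm R p k = skewSymm R p k := by
  rw [skewSymm_eq_antisymm]
  exact antisymm_spec (isCoxeterFamily_site2 hR p) k hk

/-- The columns of the skew-symmetrizer, as functionals on `Λ_R(V)`. -/
lemma exists_functional_skewSymm {R : Op2 N} (hR : IsInvolutiveSymmetry R) (k : ℕ)
    (j : Fin k → Fin N) :
    ∃ φ : SkewAlg R →ₗ[ℂ] ℂ, ∀ w, φ (SkewAlg.word R w) = skewSymm R k k w j := by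
  refine exists_functional R (f := fun w => skewSymm R k k w j) fun i hi => ?_
  ext w
  exact congrFun (congrFun ((skewSymm_spec hR le_rfl).1 i hi).1 w) j

lemma word_mem_component (R : Op2 N) {k : ℕ} (w : Fin k → Fin N) :
    SkewAlg.word R w ∈ SkewAlg.component R k := Submodule.subset_span ⟨w, rfl⟩

lemma skewSymm_eq_zero {R : Op2 N} (hR : IsInvolutiveSymmetry R) {k : ℕ}
    (h : SkewAlg.component R k = ⊥) : skewSymm R k k = 0 := by
  ext w j
  obtain ⟨φ, hφ⟩ := exists_functional_skewSymm hR k j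
  have hw := word_mem_component R w
  rw [h, Submodule.mem_bot] at hw
  rw [← hφ, hw, map_zero, Matrix.zero_apply]

/-- Any functional on `Λ_R(V)` restricts to an antisymmetric tensor on words, which `A^(k)` fixes;
if `A^(k) = 0`, every functional kills every word of length `k`. -/
lemma component_eq_bot {R : Op2 N} {k : ℕ} (h : skewSymm R k k = 0) :
    SkewAlg.component R k = ⊥ := by
  refine Submodule.span_eq_bot.2 ?_
  rintro _ ⟨w, rfl⟩
  refine eq_zero_of_forall_dual fun φ => ?_
  have := antisymm_mulVec (r := site2 R k) k fun i hi => site2_mulVec_functional R hi φ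
  rw [← skewSymm_eq_antisymm, h, Matrix.zero_mulVec] at this
  exact (congrFun this w).symm

/-- Words of length `m` are multiples `u_w e` of one vector, and column `j` of `A^(m)` is a
functional `φ_j` evaluated on words, so the entries are `u_i φ_j(e)`. -/
theorem exists_isTensorPair {R : Op2 N} (hR : IsInvolutiveSymmetry R) {m : ℕ}
    (h : Module.finrank ℂ (SkewAlg.component R m) = 1) :
    ∃ u v : (Fin m → Fin N) → ℂ, IsTensorPair R m u v := by
  obtain ⟨e, he⟩ := exists_generator_of_finrank h
  choose u hu using fun w : Fin m → Fin N => he ⟨_, word_mem_component R w⟩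
  choose φ hφ using exists_functional_skewSymm hR m
  have huv : ∀ i j, skewSymm R m m i j = u i * φ j e := by
    intro i j
    rw [← hφ, ← smul_eq_mul, ← map_smul]
    exact congrArg (φ j) (congrArg Subtype.val (hu i)).symm
  refine ⟨u, fun j => φ j e, huv, ?_⟩
  have hne : skewSymm R m m ≠ 0 := fun h0 => by
    rw [component_eq_bot h0, finrank_bot] at h
    exact zero_ne_one h
  obtain ⟨i, j, hij⟩ : ∃ i j, skewSymm R m m i j ≠ 0 := by
    by_contra! hc
    exact hne (by ext i j; exact hc i j)
  -- Idempotency at a nonzero entry reads `u_i v_j ⟨v, u⟩ = u_i v_j`, whence `⟨v, u⟩ = 1`.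
  have hsq := congrFun (congrFun (skewSymm_spec hR (le_refl m)).2 i) j
  rw [Matrix.mul_apply] at hsq
  refine mul_left_cancel₀ hij ?_
  rw [mul_one, Finset.mul_sum]
  conv_rhs => rw [← hsq]
  refine Finset.sum_congr rfl fun k _ => ?_
  rw [huv, huv, huv]
  ring

end Words

/-! ### Non-degeneracy of the tensor `v` -/

section Nondegenerate

lemma mul_ascProd {E : Type*} [Ring E] {r : ℕ → E} {a : E} {k : ℕ}
    (h : ∀ i, i < k → a * r i = -a) : a * ascProd r k = (-1) ^ k * a := by
  induction k with
  | zero => simp [ascProd]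
  | succ k ih =>
    rw [ascProd, ← mul_assoc, ih fun i hi => h i (by omega), mul_assoc, h k (by omega), pow_succ]
    simp only [mul_neg, neg_mul, mul_one]

lemma descProd_mul {E : Type*} [Ring E] {r : ℕ → E} {a : E} {k : ℕ}
    (h : ∀ i, i < k → r i * a = -a) : descProd r k * a = (-1) ^ k * a := by
  induction k with
  | zero => simp [descProd]
  | succ k ih =>
    rw [descProd, mul_assoc, ih fun i hi => h i (by omega), ← mul_assoc,
      ← ((Commute.neg_one_left (r k)).pow_left k).eq, mul_assoc, h k (by omega), pow_succ]
    simp only [mul_neg, neg_mul, mul_one]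

lemma mul_descProd {E : Type*} [Ring E] {r : ℕ → E} {a : E} {k : ℕ}
    (h : ∀ i, i < k → a * r i = -a) : a * descProd r k = (-1) ^ k * a := by
  induction k with
  | zero => simp [descProd]
  | succ k ih =>
    rw [descProd, ← mul_assoc, h k (by omega), neg_mul, ih fun i hi => h i (by omega), pow_succ]
    simp only [mul_neg, neg_mul, mul_one]

variable {N n : ℕ}

lemma embed_castSucc_apply {A : Type*} [Zero A] (M : MatT N n A) (i j : Fin (n + 1) → Fin N) :
    embed Fin.castSucc M i j =
      if i (Fin.last n) = j (Fin.last n) then M (Fin.init i) (Fin.init j) else 0 := by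
  simp only [embed]
  refine if_congr ⟨fun h => h _ fun a => (Fin.castSucc_lt_last a).ne, fun h l hl => ?_⟩ rfl rfl
  induction l using Fin.lastCases with
  | last => exact h
  | cast a => exact absurd rfl (hl a)

lemma embed_succ_apply {A : Type*} [Zero A] (M : MatT N n A) (i j : Fin (n + 1) → Fin N) :
    embed Fin.succ M i j = if i 0 = j 0 then M (Fin.tail i) (Fin.tail j) else 0 := by
  simp only [embed]
  refine if_congr ⟨fun h => h _ fun a => Fin.succ_ne_zero a, fun h l hl => ?_⟩ rfl rfl
  induction l using Fin.cases with
  | zero => exact h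
  | succ a => exact absurd rfl (hl a)

lemma sum_cons {B : Type*} [AddCommMonoid B] (F : (Fin (n + 1) → Fin N) → B) :
    ∑ k, F k = ∑ a, ∑ k' : Fin n → Fin N, F (Fin.cons a k') := by
  rw [← Fintype.sum_prod_type', ← Equiv.sum_comp (Fin.consEquiv fun _ => Fin N)]
  rfl

lemma sum_snoc {B : Type*} [AddCommMonoid B] (F : (Fin (n + 1) → Fin N) → B) :
    ∑ k, F k = ∑ a, ∑ k' : Fin n → Fin N, F (Fin.snoc k' a) := by
  rw [← Fintype.sum_prod_type', ← Equiv.sum_comp (Fin.snocEquiv fun _ => Fin N)]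
  rfl

/-- The skew-symmetrizers on the first and the last `n + 1` of `n + 2` factors satisfy a
Temperley–Lieb relation. -/
lemma skewSymm_temperleyLieb {R : Op2 N} (hR : IsInvolutiveSymmetry R)
    (h0 : skewSymm R (n + 2) (n + 2) = 0) :
    ((n + 1 : ℂ) ^ 2) • (embed Fin.castSucc (skewSymm R (n + 1) (n + 1)) *
        embed Fin.succ (skewSymm R (n + 1) (n + 1)) *
        embed Fin.castSucc (skewSymm R (n + 1) (n + 1))) =
      embed Fin.castSucc (skewSymm R (n + 1) (n + 1)) := by
  have hr := isCoxeterFamily_site2 hR (n + 2)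
  set r := site2 R (n + 2) with hrdef
  have hA : embed Fin.castSucc (skewSymm R (n + 1) (n + 1)) = antisymm r (n + 1) := by
    rw [skewSymm_eq_antisymm, ← embedHom_apply _ (Fin.castSucc_injective _), map_antisymm]
    exact antisymm_congr _ fun i hi =>
      embed_site2 R (Fin.castSucc_injective _) hi (by omega) rfl rfl
  have hA' : ascProd r (n + 1) * antisymm r (n + 1) =
      embed Fin.succ (skewSymm R (n + 1) (n + 1)) * ascProd r (n + 1) := by
    rw [skewSymm_eq_antisymm, ← embedHom_apply _ (Fin.succ_injective _), map_antisymm]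
    refine antisymm_intertwine _ fun i hi => ?_
    rw [ascProd_shift hr hi (by omega)]
    congr 1
    exact (embed_site2 R (Fin.succ_injective _) (k' := i + 1) hi (by omega) rfl rfl).symm
  rw [hA]
  set A := antisymm r (n + 1)
  set A' := embed Fin.succ (skewSymm R (n + 1) (n + 1))
  obtain ⟨h1, h2⟩ := antisymm_spec hr (n + 1) (by omega)
  have hA'' : A' = ascProd r (n + 1) * A * descProd r (n + 1) := by
    rw [hA', mul_assoc, ascProd_mul_descProd hr.sq, mul_one]
  have hl : A * ascProd r n = (-1) ^ n * A := mul_ascProd fun i hi => (h1 i (by omega)).2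
  have hd : descProd r n * A = (-1) ^ n * A := descProd_mul fun i hi => (h1 i (by omega)).1
  have hpow : ((-1 : MatT N (n + 2) ℂ) ^ n) * (-1) ^ n = 1 := by
    rw [← pow_add, (Even.add_self n).neg_one_pow]
  have hc : ∀ z : MatT N (n + 2) ℂ, Commute ((-1) ^ n) z := fun z =>
    (Commute.neg_one_left z).pow_left n
  -- This is the vanishing of `A^(n+2)`, read through its recursion.
  have hrel : A = (n + 1 : ℂ) • (A * r n * A) := by
    have hn : ((n : ℂ) + 2)⁻¹ ≠ 0 := inv_ne_zero (by exact_mod_cast Nat.succ_ne_zero (n + 1))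
    rw [skewSymm_eq_antisymm, antisymm, smul_eq_zero_iff_right hn, mul_sub, sub_mul, mul_one, h2,
      mul_smul_comm, smul_mul_assoc] at h0
    exact sub_eq_zero.1 h0
  -- `A'` is `A` conjugated by `r 0 ⋯ r n`. The first `n` generators on either side are absorbed by
  -- the outer `A`; the two signs `(-1)^n` cancel and only `r n` survives.
  have hprod : A * A' * A = A * r n * A * (r n * A) := by
    rw [hA'', ascProd, descProd]
    calc _ = (A * ascProd r n) * r n * A * r n * (descProd r n * A) := by simp only [mul_assoc]
      _ = (-1) ^ n * (A * r n * A * r n) * (-1) ^ n * A := by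
        rw [hl, hd]; simp only [mul_assoc]
      _ = ((-1) ^ n * (-1) ^ n) * (A * r n * A * r n) * A := by
        rw [mul_assoc ((-1) ^ n) (A * r n * A * r n), ← (hc (A * r n * A * r n)).eq]
        simp only [mul_assoc]
      _ = _ := by rw [hpow, one_mul, mul_assoc]
  rw [hprod, pow_two, mul_smul, ← smul_mul_assoc, ← hrel, ← mul_assoc, ← hrel]

/-- The tensor `v` is non-degenerate in the first index. -/
lemma exists_rightInverse {R : Op2 N} (hR : IsInvolutiveSymmetry R)
    (h0 : skewSymm R (n + 2) (n + 2) = 0) {u v : (Fin (n + 1) → Fin N) → ℂ}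
    (huv : IsTensorPair R (n + 1) u v) :
    ∃ w : (Fin n → Fin N) → Fin N → ℂ, ∀ a b,
      ∑ k, v (Fin.cons a k) * w k b = if a = b then 1 else 0 := by
  -- `P` and `Q` are the contractions of `u` with `v` over `n` adjacent indices that appear in `A A'
  -- A`.
  set P : Matrix (Fin N) (Fin N) ℂ := fun a b => ∑ k, v (Fin.cons a k) * u (Fin.snoc k b) with hP
  set Q : Matrix (Fin N) (Fin N) ℂ := fun a b => ∑ k, u (Fin.cons a k) * v (Fin.snoc k b) with hQ
  obtain ⟨i₀, hi₀⟩ : ∃ i, v i * u i ≠ 0 := by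
    by_contra! hc
    exact zero_ne_one ((Finset.sum_eq_zero fun i _ => hc i).symm.trans huv.pairing)
  have hTL := skewSymm_temperleyLieb hR h0
  have hAA : ∀ i j, (embed Fin.castSucc (skewSymm R (n + 1) (n + 1)) *
      embed Fin.succ (skewSymm R (n + 1) (n + 1))) i j =
      u (Fin.init i) * v (Fin.tail j) * P (j 0) (i (Fin.last _)) := by
    intro i j
    rw [Matrix.mul_apply, sum_snoc, hP, Finset.mul_sum]
    simp only [embed_castSucc_apply, embed_succ_apply, Fin.snoc_last, Fin.init_snoc, huv.skew_eq]
    rw [Finset.sum_eq_single (i (Fin.last _))]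
    · rw [sum_cons, Finset.sum_eq_single (j 0)]
      · refine Finset.sum_congr rfl fun k _ => ?_
        rw [← Fin.cons_snoc_eq_snoc_cons, Fin.cons_zero, if_pos rfl, if_pos rfl, Fin.tail_cons]
        ring
      · intro a _ ha
        refine Finset.sum_eq_zero fun k _ => ?_
        rw [← Fin.cons_snoc_eq_snoc_cons, Fin.cons_zero, if_neg ha, mul_zero]
      · simp
    · intro a _ ha
      refine Finset.sum_eq_zero fun k _ => ?_
      rw [if_neg ha.symm, zero_mul]
    · simp
  -- The Temperley–Lieb relation at a multi-index `i₀` with `v i₀ * u i₀ ≠ 0`, which can then be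
  -- cancelled.
  have hPQ : P.transpose * ((n + 1 : ℂ) ^ 2 • Q) = 1 := by
    ext b c
    have h1 := congrFun (congrFun hTL (Fin.snoc i₀ b)) (Fin.snoc i₀ c)
    rw [Matrix.smul_apply, Matrix.mul_apply, sum_snoc, Finset.sum_eq_single c] at h1
    · simp only [hAA, embed_castSucc_apply, Fin.snoc_last, if_pos, Fin.init_snoc,
        huv.skew_eq] at h1
      rw [sum_cons] at h1
      simp only [← Fin.cons_snoc_eq_snoc_cons, Fin.tail_cons, Fin.cons_zero] at h1
      refine mul_left_cancel₀ hi₀ ?_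
      rw [Matrix.mul_smul, Matrix.smul_apply, Matrix.mul_apply, Matrix.one_apply, mul_ite, mul_one,
        mul_zero, mul_comm (v i₀), ← h1, smul_eq_mul, smul_eq_mul]
      simp only [Finset.mul_sum, hQ, Matrix.transpose_apply]
      refine Finset.sum_congr rfl fun a _ => Finset.sum_congr rfl fun k _ => ?_
      ring
    · intro a _ ha
      refine Finset.sum_eq_zero fun k _ => ?_
      rw [embed_castSucc_apply, Fin.snoc_last, Fin.snoc_last, if_neg ha, mul_zero]
    · simp
  -- A one-sided inverse of a square complex matrix is two-sided. In the other order `P`, and with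
  -- it `v`, carries the free first index, and the remaining factors give `w`.
  rw [mul_eq_one_comm] at hPQ
  refine ⟨fun k c => ∑ b, u (Fin.snoc k b) * ((n + 1 : ℂ) ^ 2 * Q c b), fun a c => ?_⟩
  have h2 := congrFun (congrFun hPQ c) a
  rw [Matrix.mul_apply, Matrix.one_apply] at h2
  simp only [Matrix.smul_apply, smul_eq_mul, Matrix.transpose_apply] at h2
  rw [if_congr (eq_comm (a := a)) rfl rfl, ← h2]
  simp only [hP, Finset.mul_sum]
  rw [Finset.sum_comm]
  refine Finset.sum_congr rfl fun a _ => Finset.sum_congr rfl fun k _ => ?_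
  ring

end Nondegenerate

/-! ### The characteristic identity -/

section Characteristic

variable {N : ℕ} {A : Type*} [Ring A]

/-- A left multiple of `L - t` which is scalar vanishes at `t = L`. -/
lemma eval₂_scalar_eq_zero {L : Matrix (Fin N) (Fin N) A} {D : A[X]}
    {B : Matrix (Fin N) (Fin N) A[X]}
    (h : B * (L.map C - Matrix.scalar (Fin N) X) = Matrix.scalar (Fin N) D) :
    D.eval₂ (Matrix.scalar (Fin N)) L = 0 := by
  set b : ℕ → Matrix (Fin N) (Fin N) A := fun k => B.map fun q => q.coeff k with hb
  have hBX : B * Matrix.scalar (Fin N) X = Matrix.scalar (Fin N) X * B :=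
    (Matrix.scalar_commute (X : A[X]) (fun r => Polynomial.commute_X r) B).eq.symm
  rw [mul_sub, hBX] at h
  -- At `t^k` the hypothesis reads `D_k I = b_k L - b_{k-1}`, with `b_{-1} = 0`. Since `L` stands on
  -- the right, multiplying by `L^k` on the right makes the sum telescope.
  have hcoeff : ∀ k, Matrix.scalar (Fin N) (D.coeff k) =
      b k * L - ((Matrix.scalar (Fin N) X * B).map fun q => q.coeff k) := by
    intro k
    ext i j
    have := congrArg (fun q => q.coeff k) (congrFun (congrFun h i) j)
    simp only [Matrix.sub_apply, Matrix.mul_apply, Matrix.map_apply, coeff_sub, finsetSum_coeff,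
      coeff_mul_C] at this
    simp only [Matrix.sub_apply, Matrix.mul_apply, Matrix.map_apply, finsetSum_coeff, hb]
    rw [this, Matrix.scalar_apply, Matrix.scalar_apply, Matrix.diagonal_apply,
      Matrix.diagonal_apply]
    split_ifs <;> simp
  have hsum : ∀ K, ∑ k ∈ Finset.range (K + 1), Matrix.scalar (Fin N) (D.coeff k) * L ^ k =
      b K * L ^ (K + 1) := by
    intro K
    induction K with
    | zero =>
      have : ((Matrix.scalar (Fin N) X * B).map fun q => q.coeff 0) = 0 := by
        ext i j
        simp [Matrix.scalar_apply, Matrix.diagonal_mul]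
      rw [Finset.sum_range_one, hcoeff, this, sub_zero, pow_zero, mul_one, zero_add, pow_one]
    | succ K ih =>
      have : ((Matrix.scalar (Fin N) X * B).map fun q => q.coeff (K + 1)) = b K := by
        ext i j
        simp [Matrix.scalar_apply, Matrix.diagonal_mul, hb]
      rw [Finset.sum_range_succ, ih, hcoeff, this, sub_mul, mul_assoc, ← pow_succ', add_sub_cancel]
  -- Any `K` beyond the degrees of `D` and of all entries of `B` serves; the `+ 1` makes the
  -- inequality strict.
  obtain ⟨K, hK, hbK⟩ : ∃ K, D.natDegree ≤ K ∧ b K = 0 := by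
    refine ⟨D.natDegree + ∑ i, ∑ j, ((B i j).natDegree + 1), by omega, ?_⟩
    ext i j
    refine coeff_eq_zero_of_natDegree_lt ?_
    have h1 : (B i j).natDegree + 1 ≤ ∑ j, ((B i j).natDegree + 1) :=
      Finset.single_le_sum (f := fun j => (B i j).natDegree + 1) (fun _ _ => Nat.zero_le _)
        (Finset.mem_univ j)
    have h2 : ∑ j, ((B i j).natDegree + 1) ≤ ∑ i, ∑ j, ((B i j).natDegree + 1) :=
      Finset.single_le_sum (f := fun i => ∑ j, ((B i j).natDegree + 1))
        (fun _ _ => Nat.zero_le _) (Finset.mem_univ i)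
    omega
  rw [eval₂_eq_sum_range' _ (Nat.lt_succ_of_le hK), hsum, hbK, zero_mul]

variable [Algebra ℂ A]

lemma natDegree_smul_le_of_le {c : ℂ} {q : A[X]} {k : ℕ} (h : q.natDegree ≤ k) :
    (c • q).natDegree ≤ k := (natDegree_smul_le c q).trans h

/-- A matrix over `A[X]` whose entries have degree at most `k`, with scalar coefficient `c` in
degree `k`. -/
structure HasTop {n : Type*} [DecidableEq n] (M : Matrix n n A[X]) (k : ℕ) (c : ℂ) : Prop where
  natDegree_le : ∀ i j, (M i j).natDegree ≤ k
  coeff_eq : ∀ i j, (M i j).coeff k = if i = j then algebraMap ℂ A c else 0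

variable {n : Type*} [Fintype n] [DecidableEq n]

lemma HasTop.mul {M M' : Matrix n n A[X]} {k k' : ℕ} {c c' : ℂ} (h : HasTop M k c)
    (h' : HasTop M' k' c') : HasTop (M * M') (k + k') (c * c') where
  natDegree_le i j := by
    rw [Matrix.mul_apply]
    exact natDegree_sum_le_of_forall_le _ _ fun l _ =>
      natDegree_mul_le_of_le (h.natDegree_le i l) (h'.natDegree_le l j)
  coeff_eq i j := by
    rw [Matrix.mul_apply, finsetSum_coeff]
    simp only [coeff_mul_add_eq_of_natDegree_le (h.natDegree_le i _) (h'.natDegree_le _ j),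
      h.coeff_eq, h'.coeff_eq, map_mul]
    simp

/-- Complex entries commute with everything, so the entries of the product are complex combinations
of those of `Z`, and a scalar top coefficient is only multiplied by `M * M' = 1`. -/
lemma hasTop_scal {p : ℕ} {M M' : MatT N p ℂ} (hM : M * M' = 1) {Z : MatT N p A[X]} {k : ℕ}
    {c : ℂ} (h : HasTop Z k c) : HasTop (scal A[X] M * Z * scal A[X] M') k c := by
  have happ : ∀ i j, (scal A[X] M * Z * scal A[X] M') i j =
      ∑ l, ∑ l', (M i l' * M' l j) • Z l' l := by
    intro i j
    rw [Matrix.mul_apply]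
    refine Finset.sum_congr rfl fun l _ => ?_
    rw [Matrix.mul_apply, Finset.sum_mul]
    refine Finset.sum_congr rfl fun l' _ => ?_
    simp only [scal, Matrix.map_apply]
    rw [mul_assoc, ← Algebra.commutes, ← mul_assoc, ← map_mul, ← Algebra.smul_def]
  constructor
  · intro i j
    rw [happ]
    exact natDegree_sum_le_of_forall_le _ _ fun l _ => natDegree_sum_le_of_forall_le _ _
      fun l' _ => natDegree_smul_le_of_le (h.natDegree_le l' l)
  · intro i j
    rw [happ]
    simp only [finsetSum_coeff, coeff_smul, h.coeff_eq, smul_ite, smul_zero, Finset.sum_ite_eq',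
      Finset.mem_univ, if_true]
    rw [← Finset.sum_smul, ← Matrix.mul_apply, hM, Matrix.one_apply]
    split_ifs <;> simp

lemma hasTop_site1 (L : Matrix (Fin N) (Fin N) A) {p : ℕ} (hp : 0 < p) :
    HasTop (site1 (L.map C - Matrix.scalar (Fin N) X) p) 1 (-1) := by
  have hdeg : ∀ i j, ((L.map C - Matrix.scalar (Fin N) X : Matrix (Fin N) (Fin N) A[X]) i j).natDegree ≤ 1 := by
    intro i j
    rw [Matrix.sub_apply, Matrix.map_apply, Matrix.scalar_apply, Matrix.diagonal_apply]
    refine (natDegree_sub_le _ _).trans (max_le ((natDegree_C _).le.trans zero_le_one) ?_)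
    split_ifs
    · exact natDegree_X_le
    · simp
  constructor
  · intro i j
    rw [site1_eq_embed _ hp, embed]
    split_ifs
    · exact hdeg _ _
    · simp
  · intro i j
    rw [site1_eq_embed _ hp, embed]
    by_cases hij : i = j
    · subst hij
      simp [toOne]
    · rw [if_neg hij]
      split_ifs with h
      · have h0 : i ⟨0, hp⟩ ≠ j ⟨0, hp⟩ := by
          refine fun h0 => hij (funext fun l => ?_)
          by_cases hl : l = ⟨0, hp⟩
          · rw [hl, h0]
          · exact h l fun _ => Ne.symm hl
        simp [toOne, h0]
      · simp

lemma hasTop_copy {R : Op2 N} (hR : R * R = 1) (L : Matrix (Fin N) (Fin N) A) {p : ℕ}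
    (hp : 0 < p) (k : ℕ) :
    HasTop (copy R (L.map C - Matrix.scalar (Fin N) X) p k) 1 (-1) := by
  induction k with
  | zero => exact hasTop_site1 L hp
  | succ k ih =>
    refine hasTop_scal ?_ ih
    rw [Matrix.inv_eq_left_inv hR, site2_mul_self hR]

lemma hasTop_prod_copy {R : Op2 N} (hR : R * R = 1) (L : Matrix (Fin N) (Fin N) A) {p : ℕ}
    (hp : 0 < p) (k : ℕ) :
    HasTop ((List.range k).map (copy R (L.map C - Matrix.scalar (Fin N) X) p)).prod k
      ((-1) ^ k) := by
  induction k with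
  | zero =>
    constructor
    · intro i j
      simp only [List.range_zero, List.map_nil, List.prod_nil, Matrix.one_apply]
      split_ifs <;> simp
    · intro i j
      simp only [List.range_zero, List.map_nil, List.prod_nil, Matrix.one_apply]
      split_ifs <;> simp
  | succ k ih =>
    rw [List.range_succ, List.map_append, List.prod_append, pow_succ]
    simpa using ih.mul (hasTop_copy hR L hp k)

/-- The leading term of the quantum determinant of `L - t`. -/
lemma qdet_top {R : Op2 N} (hR : R * R = 1) (L : Matrix (Fin N) (Fin N) A) {m : ℕ} (hm : 0 < m)
    {u v : (Fin m → Fin N) → ℂ} (huv : ∑ i, v i * u i = 1) :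
    (qdet R u v (L.map C - Matrix.scalar (Fin N) X)).natDegree ≤ m ∧
      (qdet R u v (L.map C - Matrix.scalar (Fin N) X)).coeff m = (-1) ^ m := by
  have h := hasTop_prod_copy hR L hm m
  constructor
  · exact natDegree_sum_le_of_forall_le _ _ fun i _ => natDegree_sum_le_of_forall_le _ _
      fun j _ => natDegree_smul_le_of_le (h.natDegree_le i j)
  · simp only [qdet, finsetSum_coeff, coeff_smul, h.coeff_eq, smul_ite, smul_zero,
      Finset.sum_ite_eq, Finset.mem_univ, if_true]
    rw [← Finset.sum_smul, huv, one_smul]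
    simp

end Characteristic

/-! ### The left adjugate and the Cayley–Hamilton identity. -/

section CayleyHamilton

variable {N n : ℕ} {A : Type*} [Ring A] [Algebra ℂ A]

lemma scal_mul_apply {p : ℕ} {M : MatT N p ℂ} {u v : (Fin p → Fin N) → ℂ}
    (h : ∀ i j, M i j = u i * v j) (Z : MatT N p A) (i j : Fin p → Fin N) :
    (scal A M * Z) i j = u i • ∑ k, v k • Z k j := by
  rw [Matrix.mul_apply, Finset.smul_sum]
  refine Finset.sum_congr rfl fun k _ => ?_
  rw [scal, Matrix.map_apply, h, smul_smul, Algebra.smul_def]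

lemma mul_scal_apply {p : ℕ} {M : MatT N p ℂ} {u v : (Fin p → Fin N) → ℂ}
    (h : ∀ i j, M i j = u i * v j) (Z : MatT N p A) (i j : Fin p → Fin N) :
    (Z * scal A M) i j = v j • ∑ k, u k • Z i k := by
  rw [Matrix.mul_apply, Finset.smul_sum]
  refine Finset.sum_congr rfl fun k _ => ?_
  rw [scal, Matrix.map_apply, h, smul_smul, Algebra.smul_def, ← Algebra.commutes, mul_comm]

/-- A matrix `Y` subject to the reflection equation has a left adjugate with respect to the
quantum determinant. -/
lemma exists_adjugate {R : Op2 N} (hR : IsInvolutiveSymmetry R)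
    (h0 : skewSymm R (n + 2) (n + 2) = 0) {u v : (Fin (n + 1) → Fin N) → ℂ}
    (huv : IsTensorPair R (n + 1) u v) {Y : Matrix (Fin N) (Fin N) A}
    (hY : scal A (site2 R (n + 1) 0) * site1 Y (n + 1) * scal A (site2 R (n + 1) 0) *
        site1 Y (n + 1) =
      site1 Y (n + 1) * scal A (site2 R (n + 1) 0) * site1 Y (n + 1) *
        scal A (site2 R (n + 1) 0)) :
    ∃ B : Matrix (Fin N) (Fin N) A, B * Y = Matrix.scalar (Fin N) (qdet R u v Y) := by
  obtain ⟨w, hw⟩ := exists_rightInverse hR h0 huv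
  set r : ℕ → MatT N (n + 1) A := fun i => scal A (site2 R (n + 1) i) with hrdef
  have hr : IsCoxeterFamily r (n + 1) := isCoxeterFamily_scal hR A (n + 1)
  set x := site1 Y (n + 1) with hxdef
  have hx : ∀ i, 1 ≤ i → Commute (r i) x := fun i hi => commute_scal_site1 R Y i hi
  set M := copyProd r x (n + 1) with hM
  set S := scal A (skewSymm R (n + 1) (n + 1)) with hS
  have hSr : S = antisymm r (n + 1) := by
    rw [hS, skewSymm_eq_antisymm, ← scalHom_apply, map_antisymm]
    rfl
  have hD : qdet R u v Y = ∑ i, ∑ j, (v i * u j) • M i j := by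
    rw [qdet, hM, copyProd]
    simp only [funext (copy_eq_conjCopy hR.sq_eq_one Y (n + 1))]
    rfl
  have hMS : Commute M S := by
    rw [hSr]
    exact antisymm_commute _ fun i hi =>
      (commute_copyProd hr hx hY (n + 1) le_rfl i (by omega)).symm
  -- All of `M * descProd r n` except its rightmost factor `x`.
  set W := copyProd r x n * descProd r n with hW
  have key : S * (W * x) = (-1) ^ n * (M * S) := by
    have hSd : S * descProd r n = (-1) ^ n * S := by
      rw [hSr]
      exact mul_descProd fun i hi => ((antisymm_spec hr _ le_rfl).1 i (by omega)).2
    rw [hW, ← copyProd_succ_mul_descProd hr, ← hM, ← mul_assoc, ← hMS.eq, mul_assoc, hSd,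
      ← mul_assoc, ← ((Commute.neg_one_left M).pow_left n).eq, mul_assoc]
  -- Since `S` is `u ⊗ v`, contracting `key` with `v` on the left and using `⟨v, u⟩ = 1` strips off
  -- `u` and produces the determinant.
  have key' : ∀ j, ∑ k, v k • (W * x) k j = ((-1) ^ n * v j) • qdet R u v Y := by
    intro j
    have h1 : ∀ i, u i • ∑ k, v k • (W * x) k j = ((-1) ^ n * v j) • ∑ k, u k • M i k := by
      intro i
      rw [← scal_mul_apply huv.skew_eq, mul_smul, ← mul_scal_apply huv.skew_eq, ← hS, key]
      rcases neg_one_pow_eq_or (MatT N (n + 1) A) n with h | h <;>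
      rcases neg_one_pow_eq_or ℂ n with h' | h'
      · rw [h, h', one_mul, one_smul]
      · have := congrArg (algebraMap ℂ (MatT N (n + 1) A)) h'
        rw [map_pow, map_neg, map_one, h] at this
        rw [h, h', ← Matrix.smul_apply, neg_one_smul, this]
        simp
      · have := congrArg (algebraMap ℂ (MatT N (n + 1) A)) h'
        rw [map_pow, map_neg, map_one, h] at this
        rw [h, h', one_smul, this, one_mul]
      · rw [h, h', ← Matrix.smul_apply, neg_one_smul, neg_one_mul]
    have h2 := congrArg (fun f : (Fin (n + 1) → Fin N) → A => ∑ i, v i • f i) (funext h1)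
    simp only [smul_smul, ← Finset.sum_smul, huv.pairing, one_smul] at h2
    rw [h2, hD, Finset.smul_sum]
    refine Finset.sum_congr rfl fun i _ => ?_
    rw [mul_comm, mul_smul, Finset.smul_sum, Finset.smul_sum, Finset.smul_sum]
    refine Finset.sum_congr rfl fun k _ => ?_
    simp only [smul_smul]
  have hx1 : ∀ k a (j' : Fin n → Fin N), (W * x) k (Fin.cons a j') =
      ∑ c, W k (Fin.cons c j') * Y c a := by
    intro k a j'
    rw [Matrix.mul_apply, sum_cons]
    refine Finset.sum_congr rfl fun c _ => ?_
    rw [Finset.sum_eq_single j']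
    · rw [hxdef, site1_eq_embed _ (Nat.succ_pos n), embed, if_pos]
      · rfl
      · intro l hl
        induction l using Fin.cases with
        | zero => exact absurd rfl (hl 0)
        | succ l => rfl
    · intro k' _ hk'
      rw [hxdef, site1_eq_embed _ (Nat.succ_pos n), embed, if_neg, mul_zero]
      intro h
      refine hk' (funext fun l => ?_)
      exact h l.succ fun _ => (Fin.succ_ne_zero l).symm
    · simp
  obtain ⟨E, hE⟩ : ∃ E : Fin N → (Fin n → Fin N) → A, ∀ j' a,
      ∑ c, E c j' * Y c a = ((-1) ^ n * v (Fin.cons a j')) • qdet R u v Y := by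
    refine ⟨fun c j' => ∑ k, v k • W k (Fin.cons c j'), fun j' a => ?_⟩
    rw [← key']
    simp only [hx1, Finset.smul_sum, Finset.sum_mul, smul_mul_assoc]
    exact Finset.sum_comm
  -- Contraction of `E` with the inverse `w` of `v`; the sign `(-1)^n` compensates the one in `hE`.
  refine ⟨Matrix.of fun b a => ∑ j', ((-1) ^ n * w j' b) • E a j', ?_⟩
  ext b a
  rw [Matrix.mul_apply]
  simp only [Matrix.of_apply, Finset.sum_mul, smul_mul_assoc]
  rw [Finset.sum_comm]
  simp only [← Finset.smul_sum, hE, smul_smul]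
  rw [← Finset.sum_smul]
  have hpow : ((-1 : ℂ) ^ n) * (-1) ^ n = 1 := by rw [← pow_add, (Even.add_self n).neg_one_pow]
  have h4 : ∑ j', (-1) ^ n * w j' b * ((-1) ^ n * v (Fin.cons a j')) =
      if a = b then (1 : ℂ) else 0 := by
    rw [← hw a b]
    refine Finset.sum_congr rfl fun j' _ => ?_
    linear_combination (w j' b * v (Fin.cons a j')) * hpow
  rw [h4, Matrix.scalar_apply, Matrix.diagonal_apply, if_congr (eq_comm (a := a)) rfl rfl]
  split_ifs <;> simp

lemma reflection_sub_X {R : Op2 N} (hR : R * R = 1) {L : Matrix (Fin N) (Fin N) A} {p : ℕ}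
    (hp : 0 < p)
    (h : scal A (site2 R p 0) * site1 L p * scal A (site2 R p 0) * site1 L p =
      site1 L p * scal A (site2 R p 0) * site1 L p * scal A (site2 R p 0)) :
    scal A[X] (site2 R p 0) * site1 (L.map C - Matrix.scalar (Fin N) X) p *
        scal A[X] (site2 R p 0) * site1 (L.map C - Matrix.scalar (Fin N) X) p =
      site1 (L.map C - Matrix.scalar (Fin N) X) p * scal A[X] (site2 R p 0) *
        site1 (L.map C - Matrix.scalar (Fin N) X) p * scal A[X] (site2 R p 0) := by
  have hsite : site1 (L.map C - Matrix.scalar (Fin N) (X : A[X])) p =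
      (C : A →+* A[X]).mapMatrix (site1 L p) - Matrix.scalar (Fin p → Fin N) X := by
    ext1 i j
    rw [site1_eq_embed _ hp, site1_eq_embed _ hp, RingHom.mapMatrix_apply, Matrix.sub_apply,
      Matrix.map_apply, embed, embed, Matrix.scalar_apply (n := Fin p → Fin N),
      Matrix.diagonal_apply]
    split_ifs with h1 h2 h2
    · simp [toOne, h2]
    · have h0 : i ⟨0, hp⟩ ≠ j ⟨0, hp⟩ := by
        refine fun h0 => h2 (funext fun l => ?_)
        by_cases hl : l = ⟨0, hp⟩
        · rw [hl, h0]
        · exact h1 l fun _ => Ne.symm hl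
      simp [toOne, h0]
    · exact absurd (fun l _ => by rw [h2]) h1
    · simp
  have hscal : scal A[X] (site2 R p 0) = (C : A →+* A[X]).mapMatrix (scal A (site2 R p 0)) := by
    ext1 i j
    rfl
  rw [hsite]
  refine reflection_sub_central ?_ ?_ ?_
  · simp only [← scalHom_apply, ← map_mul, site2_mul_self hR, map_one]
  · rw [hscal]
    simp only [← map_mul, h]
  · exact fun z => Matrix.scalar_commute X (fun q => Polynomial.commute_X q) z

/-- The adjugate is taken over `A[X]` for `L - t`, whose determinant has top coefficient `(-1)^m`.
Nontriviality of `A` makes the degree exactly `m`. -/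
theorem isCharacteristic_qdet [Nontrivial A] {R : Op2 N} (hR : IsInvolutiveSymmetry R)
    {m : ℕ} (hm : 2 ≤ m) (h0 : skewSymm R (m + 1) (m + 1) = 0) {u v : (Fin m → Fin N) → ℂ}
    (huv : IsTensorPair R m u v) {L : Matrix (Fin N) (Fin N) A}
    (hL : scal A (site2 R 2 0) * copy R L 2 0 * copy R L 2 1 =
      copy R L 2 0 * copy R L 2 1 * scal A (site2 R 2 0)) :
    IsCharacteristic m ((-1) ^ m * qdet R u v (L.map C - Matrix.scalar (Fin N) X)) L := by
  obtain ⟨hdeg, hcoeff⟩ := qdet_top hR.sq_eq_one L (by omega) huv.pairing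
  set D := qdet R u v (L.map C - Matrix.scalar (Fin N) X) with hD
  have hC : ((-1 : A[X]) ^ m) = C ((-1) ^ m) := by simp
  have hdeg' : ((-1) ^ m * D).natDegree ≤ m := by
    rw [hC]
    exact (natDegree_C_mul_le _ _).trans hdeg
  have hone : ((-1) ^ m * D).coeff m = 1 := by
    rw [hC, coeff_C_mul, hcoeff, ← pow_add, (Even.add_self m).neg_one_pow]
  refine ⟨monic_of_natDegree_le_of_coeff_eq_one m hdeg' hone,
    natDegree_eq_of_le_of_coeff_ne_zero hdeg' (by rw [hone]; exact one_ne_zero), ?_⟩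
  obtain ⟨n, rfl⟩ : ∃ n, m = n + 1 := ⟨m - 1, by omega⟩
  obtain ⟨B, hB⟩ := exists_adjugate hR h0 huv (reflection_sub_X hR.sq_eq_one (Nat.succ_pos n)
    (reflection_of_two hR.sq_eq_one hL hm))
  refine eval₂_scalar_eq_zero (B := Matrix.scalar (Fin N) ((-1) ^ (n + 1)) * B) ?_
  rw [mul_assoc, hB, ← map_mul]

end CayleyHamilton

/-! ### The algebra `𝓛(R, F)`: nontriviality and matrix form of its relations. -/

section QMA

variable {N : ℕ}

/-- The augmentation of `𝓛(R, F)` sending all generators to zero. -/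
def QMA.augmentation (R F : Op2 N) : QMA R F →ₐ[ℂ] ℂ :=
  RingQuot.liftAlgHom ℂ ⟨FreeAlgebra.lift ℂ fun _ => 0, by
    rintro _ _ ⟨i, j, rfl, rfl⟩
    set f : FreeMat N →ₐ[ℂ] ℂ := FreeAlgebra.lift ℂ fun _ => 0 with hf
    -- Both sides of the defining relation contain this copy as a factor, so both are sent to zero.
    have h0 : f.mapMatrix (copy F (freeGen N) 2 0) = 0 := by
      ext a b
      rw [AlgHom.mapMatrix_apply, Matrix.map_apply, copy, site1_eq_embed _ two_pos, embed]
      split_ifs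
      · simp [toOne, freeGen, hf]
      · simp
    have h1 := congrFun (congrFun (show f.mapMatrix (scal (FreeMat N) (site2 R 2 0) *
      copy F (freeGen N) 2 0 * copy F (freeGen N) 2 1) = 0 by
        rw [map_mul, map_mul, h0, mul_zero, zero_mul]) i) j
    have h2 := congrFun (congrFun (show f.mapMatrix (copy F (freeGen N) 2 0 *
      copy F (freeGen N) 2 1 * scal (FreeMat N) (site2 R 2 0)) = 0 by
        rw [map_mul, map_mul, h0, zero_mul, zero_mul]) i) j
    exact h1.trans h2.symm⟩

instance (R F : Op2 N) : Nontrivial (QMA R F) := (QMA.augmentation R F).toRingHom.domain_nontrivial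

lemma map_copy {A B : Type*} [Ring A] [Algebra ℂ A] [Ring B] [Algebra ℂ B] (f : A →ₐ[ℂ] B)
    (F : Op2 N) (Y : Matrix (Fin N) (Fin N) A) {p : ℕ} (hp : 0 < p) (k : ℕ) :
    f.mapMatrix (copy F Y p k) = copy F (Y.map f) p k := by
  induction k with
  | zero =>
    rw [copy, copy, AlgHom.mapMatrix_apply, site1_eq_embed _ hp, site1_eq_embed _ hp,
      embed_map _ _ _ (map_zero f)]
    rfl
  | succ k ih =>
    rw [copy, copy, map_mul, map_mul, ih]
    congr 1
    · congr 1
      ext i j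
      simp [scal]
    · ext i j
      simp [scal]

/-- The defining relations of `𝓛(R, F)` in matrix form. -/
lemma genMat_relation (R F : Op2 N) :
    scal (QMA R F) (site2 R 2 0) * copy F (genMat R F) 2 0 * copy F (genMat R F) 2 1 =
      copy F (genMat R F) 2 0 * copy F (genMat R F) 2 1 * scal (QMA R F) (site2 R 2 0) := by
  set f : FreeMat N →ₐ[ℂ] QMA R F := RingQuot.mkAlgHom ℂ (qmaRel R F) with hf
  have hgen : (freeGen N).map f = genMat R F := rfl
  have hs : f.mapMatrix (scal (FreeMat N) (site2 R 2 0)) = scal (QMA R F) (site2 R 2 0) := by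
    ext i j
    simp [scal]
  rw [← hgen, ← map_copy f F _ two_pos, ← map_copy f F _ two_pos, ← hs]
  simp only [← map_mul]
  ext i j
  exact RingQuot.mkAlgHom_rel ℂ ⟨i, j, rfl, rfl⟩

end QMA

end RE

end

theorem mainTheorem2 (N m : ℕ) (hm : 2 ≤ m) (R : RE.Op2 N)
    (hR : RE.IsInvolutiveSymmetry R) (hEven : RE.IsEven R m) :
    (∃ u v : (Fin m → Fin N) → ℂ, RE.IsTensorPair R m u v) ∧
    ∀ u v : (Fin m → Fin N) → ℂ, RE.IsTensorPair R m u v →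
      RE.IsCharacteristic m ((-1) ^ m * RE.charDet R u v) (RE.genMat R R) :=
  ⟨RE.exists_isTensorPair hR hEven.top, fun _ _ huv => RE.isCharacteristic_qdet hR hm
    (RE.skewSymm_eq_zero hR (hEven.above _ (Nat.lt_succ_self m))) huv (RE.genMat_relation R R)⟩
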